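/- All tensors have legs with labels in $\{0,1\}$ (one qubit per leg). The building blocks are, for $s\in\{0,1\}$ and any number of legs labelled $a_1,\dots,a_m$: the blue $s$-spider $\sum_{a\in\{0,1\}}(-1)^{sa}\,\delta_{a_1,a}\cdots\delta_{a_m,a}$; the red $s$-spider $\delta_{a_1\oplus\cdots\oplus a_m,\,s}$; the green $s$-spider $i^{\pm a_1\pm\cdots\pm a_m}\,\delta_{a_1\oplus\cdots\oplus a_m,\,s}$ with any choice of signs (a minus sign marks a flipped leg); and the two-legged basis changes $\tfrac1{\sqrt2}(-1)^{ab}$, $\delta_{a,b}\,i^a$, $\tfrac1{\sqrt2}\,i^{(1+2a)b}$. An RGB tensor network $T$ is a finite collection of building blocks together with a set of disjoint pairs of their legs, which are contracted; the unpaired legs are the open legs, $n\ge 0$ in number. Contraction makes $T$ an (unnormalized, possibly zero) vector in $(\mathbb C^2)^{\otimes n}$. The Pauli group $\mathcal P_m$ on $m$ qubits is generated by the single-qubit matrices $X_j,Y_j,Z_j$ and the phase $i$. A stabilizer group is an Abelian subgroup of it that does not contain $-\mathbb 1$; its rank is its minimal number of generators, and $N(\cdot)$ denotes the normalizer in the Pauli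 group. **Proposition.** Let $T$ be an RGB tensor network with $n$ open legs. There is a stabilizer group $S\le\mathcal P_n$ of (full) rank $n$ such that: 1. $pT=T$ for all $p\in S$. If $T\neq0$, then every vector fixed by $S$ is a multiple of $T$, and $S$ contains every Pauli operator $p$ with $pT=T$. 2. For every bipartition of the open legs into inputs $A$ and outputs $B$, put $S_A=\{a\in\mathcal P_A : \bar a\otimes\mathbb 1\in S\}$ and $S_B=\{b\in\mathcal P_B : \mathbb 1\otimes b\in S\}$, where the bar is entrywise complex conjugation. These are stabilizer groups, and there is a group isomorphism $$\varphi: N(S_A)/S_A\to N(S_B)/S_B$$ such that, for $a\in N(S_A)$ and $b\in N(S_B)$, $\varphi(aS_A)=bS_B$ if and only if $\bar a\otimes b\in S$. It is the action of the network by conjugation: let $M:A\to B$ be $T$ read as a linear map from the input legs to the output legs, and let $\Pi_{S_B}=|S_B|^{-1}\sum_{s\in S_B}s$ be the projector onto the code of $S_B$. There is a real constant $c$, positive if $T\ne0$, such that for all $a\in N(S_A)$ and $b\in N(S_B)$ with $\varphi(aS_A)=bS_B$, $$Ma=bM\qquad\text{and}\qquad MaM^\dagger=c\,b\,\Pi_{S_B}.$$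 -/

import Mathlib

open scoped Matrix

noncomputable section

/-! ## Paulis, stabilizer groups and logical Pauli groups

The computational basis of the qubits labelled by a finite type `ι` is `ι → Fin 2`. -/

/-- The operators on the qubits labelled by `ι`, as matrices in the computational basis. -/
abbrev QubitOp (ι : Type*) := Matrix (ι → Fin 2) (ι → Fin 2) ℂ

def pauliX : Matrix (Fin 2) (Fin 2) ℂ := !![0, 1; 1, 0]

def pauliY : Matrix (Fin 2) (Fin 2) ℂ := !![0, -Complex.I; Complex.I, 0]

def pauliZ : Matrix (Fin 2) (Fin 2) ℂ := !![1, 0; 0, -1]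

/-- The single-qubit operator `M` on qubit `j`, tensored with the identity on all others. -/
def onQubit {ι : Type*} [Fintype ι] [DecidableEq ι] (j : ι) (M : Matrix (Fin 2) (Fin 2) ℂ) :
    QubitOp ι :=
  Matrix.of fun x y => if ∀ k, k ≠ j → x k = y k then M (x j) (y j) else 0

/-- The Pauli group on the qubits `ι`: the group of matrices generated by the single-qubit
Pauli matrices and the phase `i`. -/
def pauliGroup (ι : Type*) [Fintype ι] [DecidableEq ι] : Subgroup (QubitOp ι)ˣ :=
  Subgroup.closure {u | (u : QubitOp ι) = Complex.I • (1 : QubitOp ι) ∨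
    ∃ j, (u : QubitOp ι) = onQubit j pauliX ∨ (u : QubitOp ι) = onQubit j pauliY ∨
      (u : QubitOp ι) = onQubit j pauliZ}

abbrev Pauli (ι : Type*) [Fintype ι] [DecidableEq ι] := ↥(pauliGroup ι)

/-- The matrix of a Pauli operator. -/
def Pauli.op {ι : Type*} [Fintype ι] [DecidableEq ι] (p : Pauli ι) : QubitOp ι :=
  ((p : (QubitOp ι)ˣ) : QubitOp ι)

/-- A stabilizer group: an Abelian subgroup of the Pauli group that does not contain `-1`. -/
structure IsStabilizerGroup {ι : Type*} [Fintype ι] [DecidableEq ι]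
    (S : Subgroup (Pauli ι)) : Prop where
  comm : ∀ p ∈ S, ∀ q ∈ S, p * q = q * p
  neg_one_notMem : ∀ p ∈ S, p.op ≠ -1

/-- The rank of `S`, the minimal number of generators, equals `r`. -/
def HasRank {G : Type*} [Group G] (S : Subgroup G) (r : ℕ) : Prop :=
  IsLeast {k | ∃ g : Finset G, g.card = k ∧ Subgroup.closure (g : Set G) = S} r

/-- Every element of `S` fixes the (unnormalized) state vector `ψ`. -/
def Stabilizes {ι : Type*} [Fintype ι] [DecidableEq ι] (S : Subgroup (Pauli ι))
    (ψ : (ι → Fin 2) → ℂ) : Prop :=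
  ∀ p ∈ S, p.op *ᵥ ψ = ψ

/-- The logical Pauli group `N(S)/S`, with the normalizer taken in the Pauli group. -/
abbrev LogicalPauli {ι : Type*} [Fintype ι] [DecidableEq ι] (S : Subgroup (Pauli ι)) :=
  ↥(Subgroup.normalizer (S : Set (Pauli ι))) ⧸ S.subgroupOf (Subgroup.normalizer (S : Set (Pauli ι)))

/-- The projector `|S|⁻¹ ∑_{s ∈ S} s` onto the code stabilized by the (finite) group `S`. -/
def codeProjector {ι : Type*} [Fintype ι] [DecidableEq ι] (S : Subgroup (Pauli ι)) :
    QubitOp ι :=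
  (Nat.card S : ℂ)⁻¹ • ∑ᶠ s : S, (s : Pauli ι).op

/-! ## Bipartitions -/

/-- Join a labelling of `A` and a labelling of its complement. -/
def joinLabels {ι : Type*} [Fintype ι] [DecidableEq ι] (A : Finset ι)
    (x : A → Fin 2) (y : ↥(Aᶜ) → Fin 2) : ι → Fin 2 :=
  fun l => if h : l ∈ A then x ⟨l, h⟩ else y ⟨l, Finset.mem_compl.mpr h⟩

/-- The tensor product `P ⊗ Q` of an operator on `A` and an operator on its complement. -/
def tensorOp {ι : Type*} [Fintype ι] [DecidableEq ι] (A : Finset ι)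
    (P : QubitOp A) (Q : QubitOp ↥(Aᶜ)) : QubitOp ι :=
  Matrix.of fun x y => P (fun l => x l) (fun l => y l) * Q (fun l => x l) (fun l => y l)

/-- A state on all qubits, read as a linear map from the qubits in `A` (columns) to the
qubits in the complement of `A` (rows). -/
def stateAsMap {ι : Type*} [Fintype ι] [DecidableEq ι] (A : Finset ι)
    (ψ : (ι → Fin 2) → ℂ) : Matrix (↥(Aᶜ) → Fin 2) (A → Fin 2) ℂ :=
  Matrix.of fun y x => ψ (joinLabels A x y)

/-- The operator `a* ⊗ b` belongs to `S`, with `a*` the entrywise complex conjugate of `a`.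
As `a` is unitary, `a* ⊗ b` fixes a state `ψ` iff `b ∘ M = M ∘ a`, where `M` is `ψ` read as a
linear map from `A` to its complement. -/
def Correspond {ι : Type*} [Fintype ι] [DecidableEq ι] (S : Subgroup (Pauli ι)) (A : Finset ι)
    (a : Pauli A) (b : Pauli ↥(Aᶜ)) : Prop :=
  ∃ p ∈ S, p.op = tensorOp A (a.op.map star) b.op

/-! ## RGB tensor networks -/

/-- The elementary building blocks: spiders of the three colors with `n` legs and sign `s`
(for the green ones `flip` marks the flipped legs), and the three two-legged basis changes. -/
inductive RGBBlock : Type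
  | red (n : ℕ) (s : Fin 2)
  | green (n : ℕ) (s : Fin 2) (flip : Fin n → Bool)
  | blue (n : ℕ) (s : Fin 2)
  | hadamard
  | phase
  | hadamardPhase

/-- The number of legs. -/
def RGBBlock.arity : RGBBlock → ℕ
  | .red n _ => n
  | .green n _ _ => n
  | .blue n _ => n
  | .hadamard => 2
  | .phase => 2
  | .hadamardPhase => 2

/-- The entries of the building blocks in the computational basis. (The blue spider is written
as the sum over the common label of its legs.) -/
def RGBBlock.tensor : (t : RGBBlock) → (Fin t.arity → Fin 2) → ℂ
  | .red n s, x => if (∑ i : Fin n, (x i : ℕ)) % 2 = s then 1 else 0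
  | .green n s flip, x =>
      if (∑ i : Fin n, (x i : ℕ)) % 2 = s then
        ∏ i : Fin n, (if flip i then -Complex.I else Complex.I) ^ (x i : ℕ)
      else 0
  | .blue n s, x => ∑ a : Fin 2, if ∀ i : Fin n, (x i : ℕ) = a then (-1) ^ ((s : ℕ) * (a : ℕ)) else 0
  | .hadamard, x =>
      ((Real.sqrt 2 : ℝ) : ℂ)⁻¹ * (-1) ^ ((x (0 : Fin 2) : ℕ) * (x (1 : Fin 2) : ℕ))
  | .phase, x => if x (0 : Fin 2) = x (1 : Fin 2) then Complex.I ^ (x (0 : Fin 2) : ℕ) else 0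
  | .hadamardPhase, x =>
      ((Real.sqrt 2 : ℝ) : ℂ)⁻¹ *
        Complex.I ^ ((1 + 2 * (x (0 : Fin 2) : ℕ)) * (x (1 : Fin 2) : ℕ))

/-- An RGB tensor network with set of tensors `V`. The involution `link` on the legs of all the
tensors exchanges the two ends of every contracted edge and fixes the open legs. -/
structure RGBNetwork (V : Type*) where
  block : V → RGBBlock
  link : (Σ v, Fin (block v).arity) → (Σ v, Fin (block v).arity)
  link_link : ∀ l, link (link l) = l

namespace RGBNetwork

variable {V : Type*}

abbrev Leg (T : RGBNetwork V) := Σ v, Fin (T.block v).arity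

abbrev OpenLeg (T : RGBNetwork V) := {l : T.Leg // T.link l = l}

/-- The contracted network as a state on its open legs: multiply the entries of all the tensors
and sum over the labels of the contracted edges. -/
def tensor [Fintype V] [DecidableEq V] (T : RGBNetwork V) (x : T.OpenLeg → Fin 2) : ℂ :=
  ∑ y : T.Leg → Fin 2,
    if (∀ l, y (T.link l) = y l) ∧ (∀ l : T.OpenLeg, y l = x l) then
      ∏ v, (T.block v).tensor fun i => y ⟨v, i⟩
    else 0

end RGBNetwork

end

/-! Up to phases, Pauli operators are Weyl operators `weyl v` indexed by vectors `v` over the field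
with two elements. Phases aside, products become sums, and two operators commute or anticommute
according to the symplectic form `sform` (`weyl_comm`). Questions about stabilizer groups thus
become questions about subspaces and their orthogonals.

Call a vector stabilized (`IsStab`) if it is an eigenvector, or zero, for all Weyl operators of a
coisotropic subspace `L`, meaning that the orthogonal of `L` lies in `L`. Asking for coisotropic
rather than Lagrangian lets zero vectors through, so that contraction needs no case distinction; for
a nonzero vector, isotropy is automatic. Contraction is symplectic reduction, which preserves
coisotropy because orthogonals exchange intersections and sums (`orthogonal_reduction_le`,
`IsStab.contract`). Every block is a parity state, a cat state or a graph state, and a network is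
the product of its blocks contracted with Bell pairs; hence it is stabilized
(`RGBNetwork.isStab_tensor`).

For a nonzero stabilized vector, the Paulis fixing it have a Lagrangian space of exponents, which
gives full rank. An operator with enough Pauli symmetry has Weyl coefficients only on the stabilizer
group (`smul_eq_trace_smul_finsum`). Applied to the rank one operator of the state, this gives
uniqueness; applied to the product of `M` and its adjoint, it gives a multiple of the code
projector.

For a bipartition, the pairs `(a, b)` with `a* ⊗ b` in `S` form a subgroup `corr` of a product. Its
slices over the identity are the two local stabilizer groups, and its projections are their
normalizers, again by symplectic reduction. Goursat's lemma then yields the isomorphism. A vanishing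
network borrows the group of a basis state. -/

noncomputable section

/-! ## Signs and bits -/

/-- The nontrivial sign character of `ZMod 2`. -/
def sgn (a : ZMod 2) : ℂ := if a = 0 then 1 else -1

/-- A qubit label as an element of the field with two elements. -/
def bit (x : Fin 2) : ZMod 2 := ((x : ℕ) : ZMod 2)

/-- Add `a` to the label `x`. -/
def flipBit (a : ZMod 2) (x : Fin 2) : Fin 2 := if a = 0 then x else 1 - x

theorem zmod_two_cases (a : ZMod 2) : a = 0 ∨ a = 1 := by revert a; decide

@[simp] theorem sgn_zero : sgn 0 = 1 := by simp [sgn]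

@[simp] theorem sgn_one : sgn 1 = -1 := by simp [sgn]

theorem sgn_add (a b : ZMod 2) : sgn (a + b) = sgn a * sgn b := by
  rcases zmod_two_cases a with rfl | rfl <;> rcases zmod_two_cases b with rfl | rfl <;>
    simp [sgn, show (1 + 1 : ZMod 2) = 0 from rfl]

theorem sgn_sum {κ : Type*} (s : Finset κ) (f : κ → ZMod 2) :
    sgn (∑ i ∈ s, f i) = ∏ i ∈ s, sgn (f i) := by
  classical
  induction s using Finset.induction_on with
  | empty => simp
  | insert i s hi ih => rw [Finset.sum_insert hi, Finset.prod_insert hi, sgn_add, ih]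

@[simp] theorem sgn_mul_self (a : ZMod 2) : sgn a * sgn a = 1 := by
  rcases zmod_two_cases a with rfl | rfl <;> simp

theorem sgn_ne_zero (a : ZMod 2) : sgn a ≠ 0 := by
  rcases zmod_two_cases a with rfl | rfl <;> simp

@[simp] theorem star_sgn (a : ZMod 2) : star (sgn a) = sgn a := by
  rcases zmod_two_cases a with rfl | rfl <;> simp

theorem add_self_zmod_two (a : ZMod 2) : a + a = 0 := CharTwo.add_self_eq_zero a

@[simp] theorem bit_zero : bit 0 = 0 := rfl

@[simp] theorem bit_one : bit 1 = 1 := rfl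

@[simp] theorem flipBit_zero (x : Fin 2) : flipBit 0 x = x := by simp [flipBit]

@[simp] theorem flipBit_one_zero : flipBit 1 0 = 1 := by decide

@[simp] theorem flipBit_one_one : flipBit 1 1 = 0 := by decide

@[simp] theorem bit_flipBit (a : ZMod 2) (x : Fin 2) : bit (flipBit a x) = bit x + a := by
  revert a x; decide

/-! ## Single-qubit Weyl operators -/

/-- The single-qubit operator `X ^ p.1 * Z ^ p.2`. -/
def site (p : ZMod 2 × ZMod 2) : Matrix (Fin 2) (Fin 2) ℂ :=
  Matrix.of fun x y => if y = flipBit p.1 x then sgn (p.2 * bit y) else 0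

theorem site_apply (p : ZMod 2 × ZMod 2) (x y : Fin 2) :
    site p x y = if y = flipBit p.1 x then sgn (p.2 * bit y) else 0 := rfl

theorem site_mul (p q : ZMod 2 × ZMod 2) (x y : Fin 2) :
    ∑ z, site p x z * site q z y = sgn (p.2 * q.1) * site (p + q) x y := by
  obtain ⟨a, b⟩ := p
  obtain ⟨c, d⟩ := q
  rcases zmod_two_cases a with rfl | rfl <;> rcases zmod_two_cases b with rfl | rfl <;>
  rcases zmod_two_cases c with rfl | rfl <;> rcases zmod_two_cases d with rfl | rfl <;>
  fin_cases x <;> fin_cases y <;>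
    simp [site_apply, Fin.sum_univ_two, show (1 + 1 : ZMod 2) = 0 from rfl]

theorem site_transpose (p : ZMod 2 × ZMod 2) (x y : Fin 2) :
    site p y x = sgn (p.1 * p.2) * site p x y := by
  obtain ⟨a, b⟩ := p
  rcases zmod_two_cases a with rfl | rfl <;> rcases zmod_two_cases b with rfl | rfl <;>
  fin_cases x <;> fin_cases y <;> simp [site_apply]

/-- Up to normalization, the four operators form an orthonormal basis of the two by two matrices;
this is the source of `weyl_expansion`. -/
theorem site_complete (a b c d : Fin 2) :
    ∑ p, site p a b * site p c d = if a = c ∧ b = d then 2 else 0 := by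
  rw [Fintype.sum_prod_type]
  have h2 : ∀ f : ZMod 2 → ℂ, ∑ i, f i = f 0 + f 1 := fun f => Fin.sum_univ_two f
  simp only [h2]
  fin_cases a <;> fin_cases b <;> fin_cases c <;> fin_cases d <;>
    norm_num [site_apply]

theorem star_site (p : ZMod 2 × ZMod 2) (x y : Fin 2) : star (site p x y) = site p x y := by
  simp only [site_apply]
  split_ifs <;> simp

theorem site_zero (x y : Fin 2) : site 0 x y = if x = y then 1 else 0 := by
  simp [site_apply, eq_comm]

theorem sum_site_diag (p : ZMod 2 × ZMod 2) : ∑ x, site p x x = if p = 0 then 2 else 0 := by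
  obtain ⟨a, b⟩ := p
  rcases zmod_two_cases a with rfl | rfl <;> rcases zmod_two_cases b with rfl | rfl <;>
    norm_num [site_apply, Fin.sum_univ_two]

/-! ## Weyl operators -/

/-- The symplectic space of the qubits `ι`: an `X` and a `Z` exponent for every qubit. -/
abbrev PhaseSpace (ι : Type*) := ι → ZMod 2 × ZMod 2

theorem phaseSpace_add_self {ι : Type*} (v : PhaseSpace ι) : v + v = 0 := by
  funext i
  exact Prod.ext (add_self_zmod_two _) (add_self_zmod_two _)

section Weyl

variable {ι : Type*} [Fintype ι]

/-- The tensor product of the operators `X ^ (v i).1 * Z ^ (v i).2`. -/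
def weyl (v : PhaseSpace ι) : QubitOp ι := Matrix.of fun x y => ∏ i, site (v i) (x i) (y i)

theorem weyl_apply (v : PhaseSpace ι) (x y : ι → Fin 2) :
    weyl v x y = ∏ i, site (v i) (x i) (y i) := rfl

/-- The symplectic form. -/
def sform : LinearMap.BilinForm (ZMod 2) (PhaseSpace ι) :=
  LinearMap.mk₂ (ZMod 2) (fun u v => ∑ i, ((u i).1 * (v i).2 + (u i).2 * (v i).1))
    (fun u u' v => by rw [← Finset.sum_add_distrib]; congr! 1; simp; ring)
    (fun c u v => by rw [Finset.smul_sum]; congr! 1; simp; ring)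
    (fun u v v' => by rw [← Finset.sum_add_distrib]; congr! 1; simp; ring)
    (fun c u v => by rw [Finset.smul_sum]; congr! 1; simp; ring)

theorem sform_apply (u v : PhaseSpace ι) :
    sform u v = ∑ i, ((u i).1 * (v i).2 + (u i).2 * (v i).1) := rfl

theorem sform_comm (u v : PhaseSpace ι) : sform u v = sform v u := by
  simp only [sform_apply]
  congr! 1
  ring

theorem sform_isRefl : (sform (ι := ι)).IsRefl := fun u v h => by rw [sform_comm, h]

theorem sform_single [DecidableEq ι] (u : PhaseSpace ι) (i : ι) (p : ZMod 2 × ZMod 2) :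
    sform u (Pi.single i p) = (u i).1 * p.2 + (u i).2 * p.1 := by
  rw [sform_apply, Finset.sum_eq_single i]
  · simp
  · intro j _ hj
    simp [Pi.single_eq_of_ne hj]
  · simp

theorem sform_single_left [DecidableEq ι] (u : PhaseSpace ι) (i : ι) (p : ZMod 2 × ZMod 2) :
    sform (Pi.single i p) u = (u i).1 * p.2 + (u i).2 * p.1 := by
  rw [sform_comm, sform_single]

theorem eq_zero_of_site_form {q : ZMod 2 × ZMod 2}
    (h : ∀ p : ZMod 2 × ZMod 2, q.1 * p.2 + q.2 * p.1 = 0) : q = 0 := by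
  have h1 := h (0, 1)
  have h2 := h (1, 0)
  exact Prod.ext (by simpa using h1) (by simpa using h2)

theorem sform_nondegenerate : (sform (ι := ι)).Nondegenerate := by
  classical
  have key : ∀ u : PhaseSpace ι, (∀ v, sform u v = 0) → u = 0 := fun u hu => by
    funext i
    exact eq_zero_of_site_form fun p => by rw [← sform_single, hu]
  exact ⟨key, fun u hu => key u fun v => by rw [sform_comm]; exact hu v⟩

theorem weyl_transpose (v : PhaseSpace ι) :
    (weyl v)ᵀ = sgn (∑ i, (v i).1 * (v i).2) • weyl v := by
  ext x y
  rw [Matrix.transpose_apply, Matrix.smul_apply, smul_eq_mul, sgn_sum, weyl_apply, weyl_apply,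
    ← Finset.prod_mul_distrib]
  exact Finset.prod_congr rfl fun i _ => site_transpose _ _ _

theorem weyl_map_star (v : PhaseSpace ι) : (weyl v).map star = weyl v := by
  ext x y
  rw [Matrix.map_apply, weyl_apply, star_prod]
  exact Finset.prod_congr rfl fun i _ => star_site _ _ _

theorem weyl_conjTranspose (v : PhaseSpace ι) : (weyl v)ᴴ = (weyl v)ᵀ := by
  rw [Matrix.conjTranspose, Matrix.transpose_map, weyl_map_star]

variable [DecidableEq ι]

theorem weyl_mul (u v : PhaseSpace ι) :
    weyl u * weyl v = sgn (∑ i, (u i).2 * (v i).1) • weyl (u + v) := by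
  ext x y
  rw [Matrix.mul_apply, Matrix.smul_apply, smul_eq_mul, sgn_sum, weyl_apply,
    ← Finset.prod_mul_distrib]
  simp only [Pi.add_apply, ← site_mul, weyl_apply, ← Finset.prod_mul_distrib]
  rw [Fintype.prod_sum]

theorem weyl_comm (u v : PhaseSpace ι) :
    weyl u * weyl v = sgn (sform u v) • (weyl v * weyl u) := by
  rw [weyl_mul, weyl_mul, smul_smul, add_comm v u, ← sgn_add, sform_apply,
    ← Finset.sum_add_distrib]
  congr 3
  funext i
  linear_combination -(add_self_zmod_two ((v i).2 * (u i).1))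

@[simp] theorem weyl_zero : weyl (0 : PhaseSpace ι) = 1 := by
  ext x y
  rw [weyl_apply, Matrix.one_apply]
  simp only [Pi.zero_apply, site_zero, Finset.prod_ite_zero, Finset.prod_const_one]
  simp [funext_iff]

theorem weyl_transpose_mul_self (v : PhaseSpace ι) : (weyl v)ᵀ * weyl v = 1 := by
  rw [weyl_transpose, Matrix.smul_mul, weyl_mul, phaseSpace_add_self, weyl_zero, smul_smul]
  simp only [mul_comm ((v _).2), sgn_mul_self, one_smul]

theorem weyl_mul_self (v : PhaseSpace ι) :
    weyl v * weyl v = sgn (∑ i, (v i).1 * (v i).2) • (1 : QubitOp ι) := by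
  rw [weyl_mul, phaseSpace_add_self, weyl_zero]
  simp only [mul_comm ((v _).2)]

theorem weyl_trace (v : PhaseSpace ι) :
    (weyl v).trace = if v = 0 then 2 ^ Fintype.card ι else 0 := by
  rw [Matrix.trace]
  simp only [Matrix.diag_apply, weyl_apply]
  rw [← Fintype.prod_sum (fun i x => site (v i) x x)]
  simp only [sum_site_diag, Finset.prod_ite_zero]
  simp [funext_iff]

theorem weyl_complete (a b c d : ι → Fin 2) :
    ∑ v, weyl v a b * weyl v c d = if a = c ∧ b = d then 2 ^ Fintype.card ι else 0 := by
  simp only [weyl_apply, ← Finset.prod_mul_distrib]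
  rw [← Fintype.prod_sum (fun i p => site p (a i) (b i) * site p (c i) (d i))]
  simp only [site_complete, Finset.prod_ite_zero]
  simp [funext_iff, forall_and]

/-- Every operator is a combination of Weyl operators. -/
theorem weyl_expansion (ρ : QubitOp ι) :
    (2 ^ Fintype.card ι : ℂ) • ρ = ∑ v, ((weyl v)ᵀ * ρ).trace • weyl v := by
  ext c d
  rw [Matrix.sum_apply]
  simp only [Matrix.smul_apply, smul_eq_mul, Matrix.trace, Matrix.diag_apply, Matrix.mul_apply,
    Matrix.transpose_apply, Finset.sum_mul]
  rw [Finset.sum_comm]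
  have h : ∀ b a : ι → Fin 2, ∑ v, weyl v a b * ρ a b * weyl v c d
      = if a = c ∧ b = d then 2 ^ Fintype.card ι * ρ a b else 0 := fun b a => by
    simp only [mul_right_comm _ (ρ a b), ← Finset.sum_mul, weyl_complete, ite_mul, zero_mul]
  calc _ = ∑ b, ∑ a, ∑ v, weyl v a b * ρ a b * weyl v c d := by
        simp only [h]
        rw [Finset.sum_eq_single d]
        · rw [Finset.sum_eq_single c] <;> simp +contextual
        · intro b _ hb
          simp [hb]
        · simp
    _ = _ := Finset.sum_congr rfl fun b _ => Finset.sum_comm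

theorem weyl_mulVec (v : PhaseSpace ι) (ψ : (ι → Fin 2) → ℂ) (x : ι → Fin 2) :
    (weyl v *ᵥ ψ) x
      = (∏ i, sgn ((v i).2 * (bit (x i) + (v i).1))) * ψ fun i => flipBit (v i).1 (x i) := by
  rw [Matrix.mulVec, dotProduct, Finset.sum_eq_single fun i => flipBit (v i).1 (x i)]
  · congr 1
    rw [weyl_apply]
    simp [site_apply]
  · intro y _ hy
    obtain ⟨i, hi⟩ := Function.ne_iff.mp hy
    rw [weyl_apply, Finset.prod_eq_zero (Finset.mem_univ i), zero_mul]
    simp [site_apply, hi]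
  · simp

end Weyl

/-! ## The Pauli group in terms of Weyl operators -/

section PauliWeyl

variable {ι : Type*} [Fintype ι] [DecidableEq ι]

/-- Distinct Weyl operators are orthogonal for the trace pairing, so the matrix determines the
exponents and `Pauli.vec` does not depend on choices. -/
theorem eq_of_smul_weyl_eq {a b : ℂ} (ha : a ≠ 0) {u v : PhaseSpace ι}
    (h : a • weyl u = b • weyl v) : u = v := by
  have h1 := congrArg (fun M => ((weyl u)ᵀ * M).trace) h
  simp only [Matrix.mul_smul, Matrix.trace_smul, weyl_transpose, Matrix.smul_mul, weyl_mul,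
    weyl_trace, smul_eq_mul] at h1
  by_contra hne
  have h2 : u + v ≠ 0 := fun h0 => hne <| by
    rw [← add_zero u, ← phaseSpace_add_self v, ← add_assoc, h0, zero_add]
  simp [h2, phaseSpace_add_self, ha, sgn_ne_zero] at h1

theorem onQubit_site (j : ι) (p : ZMod 2 × ZMod 2) :
    onQubit j (site p) = weyl (Pi.single j p) := by
  ext x y
  rw [weyl_apply, onQubit, Matrix.of_apply,
    ← Finset.mul_prod_erase _ _ (Finset.mem_univ j), Pi.single_eq_same]
  have h : ∏ i ∈ Finset.univ.erase j, site ((Pi.single j p : PhaseSpace ι) i) (x i) (y i)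
      = ∏ i ∈ Finset.univ.erase j, if x i = y i then 1 else 0 :=
    Finset.prod_congr rfl fun i hi => by
      rw [Pi.single_eq_of_ne (Finset.ne_of_mem_erase hi), site_zero]
  rw [h, Finset.prod_ite_zero]
  simp

theorem onQubit_smul (j : ι) (c : ℂ) (M : Matrix (Fin 2) (Fin 2) ℂ) :
    onQubit j (c • M) = c • onQubit j M := by
  ext x y
  simp [onQubit]

theorem pauliX_eq : pauliX = site (1, 0) := by
  ext x y
  fin_cases x <;> fin_cases y <;> simp [pauliX, site_apply]

theorem pauliZ_eq : pauliZ = site (0, 1) := by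
  ext x y
  fin_cases x <;> fin_cases y <;> simp [pauliZ, site_apply]

theorem pauliY_eq : pauliY = Complex.I • site (1, 1) := by
  ext x y
  fin_cases x <;> fin_cases y <;> simp [pauliY, site_apply]

namespace Pauli

theorem op_mul (p q : Pauli ι) : (p * q).op = p.op * q.op := rfl

@[simp] theorem op_one : (1 : Pauli ι).op = 1 := rfl

theorem op_injective : Function.Injective (op (ι := ι)) :=
  fun _ _ h => Subtype.ext (Units.ext h)

theorem op_inv_mul (p : Pauli ι) : p⁻¹.op * p.op = 1 := by rw [← op_mul, inv_mul_cancel, op_one]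

theorem op_mul_inv (p : Pauli ι) : p.op * p⁻¹.op = 1 := by rw [← op_mul, mul_inv_cancel, op_one]

theorem exists_op_eq_of_inv {u : (QubitOp ι)ˣ} {k : ℕ} {v : PhaseSpace ι}
    (h : (u : QubitOp ι) = Complex.I ^ k • weyl v) :
    ∃ k : ℕ, ∃ v : PhaseSpace ι, ((u⁻¹ : (QubitOp ι)ˣ) : QubitOp ι) = Complex.I ^ k • weyl v := by
  obtain ⟨m, hm⟩ : ∃ m : ℕ, Complex.I ^ m = sgn (∑ i, (v i).1 * (v i).2) := by
    rcases zmod_two_cases (∑ i, (v i).1 * (v i).2) with h | h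
    · exact ⟨0, by simp [h]⟩
    · exact ⟨2, by simp [h]⟩
  -- The power `3 * k` inverts the phase `i ^ k`, and `i ^ m` is the sign of the square of `weyl v`.
  refine ⟨m + 3 * k, v, ?_⟩
  rw [Units.inv_eq_of_mul_eq_one_left]
  rw [h, Matrix.smul_mul, Matrix.mul_smul, weyl_mul_self, smul_smul, smul_smul, ← hm, ← pow_add,
    ← pow_add, show m + 3 * k + k + m = 4 * k + 2 * m by ring, pow_add, pow_mul, pow_mul',
    hm, Complex.I_pow_four, one_pow, one_mul, sq, sgn_mul_self, one_smul]

/-- Every Pauli operator is a Weyl operator up to a power of `i`. -/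
theorem exists_op_eq (p : Pauli ι) : ∃ k : ℕ, ∃ v : PhaseSpace ι, p.op = Complex.I ^ k • weyl v := by
  obtain ⟨u, hu⟩ := p
  change ∃ k : ℕ, ∃ v : PhaseSpace ι, (u : QubitOp ι) = Complex.I ^ k • weyl v
  induction hu using Subgroup.closure_induction with
  | mem u hu =>
    rcases hu with h | ⟨j, h | h | h⟩
    · exact ⟨1, 0, by simpa using h⟩
    · exact ⟨0, Pi.single j (1, 0), by rw [h, pauliX_eq, onQubit_site, pow_zero, one_smul]⟩
    · exact ⟨1, Pi.single j (1, 1), by rw [h, pauliY_eq, onQubit_smul, onQubit_site, pow_one]⟩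
    · exact ⟨0, Pi.single j (0, 1), by rw [h, pauliZ_eq, onQubit_site, pow_zero, one_smul]⟩
  | one => exact ⟨0, 0, by simp⟩
  | mul u v _ _ hu hv =>
    obtain ⟨k, a, hu⟩ := hu
    obtain ⟨l, b, hv⟩ := hv
    rcases zmod_two_cases (∑ i, (a i).2 * (b i).1) with h | h
    · refine ⟨k + l, a + b, ?_⟩
      rw [Units.val_mul, hu, hv, Matrix.smul_mul, Matrix.mul_smul, weyl_mul, h, smul_smul,
        smul_smul, pow_add, sgn_zero, mul_one]
    · refine ⟨k + l + 2, a + b, ?_⟩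
      rw [Units.val_mul, hu, hv, Matrix.smul_mul, Matrix.mul_smul, weyl_mul, h, smul_smul,
        smul_smul, pow_add, pow_add, sgn_one, Complex.I_sq]
  | inv u _ hu =>
    obtain ⟨k, a, hu⟩ := hu
    exact exists_op_eq_of_inv hu

/-- The exponents of a Pauli operator. -/
def vec (p : Pauli ι) : PhaseSpace ι := p.exists_op_eq.choose_spec.choose

theorem op_eq_smul_weyl (p : Pauli ι) : ∃ k : ℕ, p.op = Complex.I ^ k • weyl p.vec :=
  ⟨_, p.exists_op_eq.choose_spec.choose_spec⟩

theorem I_pow_ne_zero (k : ℕ) : Complex.I ^ k ≠ 0 := pow_ne_zero _ Complex.I_ne_zero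

theorem vec_eq {p : Pauli ι} {c : ℂ} {v : PhaseSpace ι} (h : p.op = c • weyl v) : p.vec = v := by
  obtain ⟨k, hk⟩ := p.op_eq_smul_weyl
  exact eq_of_smul_weyl_eq (I_pow_ne_zero k) (hk.symm.trans h)

@[simp] theorem vec_one : (1 : Pauli ι).vec = 0 := vec_eq (c := 1) (by simp)

@[simp] theorem vec_mul (p q : Pauli ι) : (p * q).vec = p.vec + q.vec := by
  obtain ⟨k, hk⟩ := p.op_eq_smul_weyl
  obtain ⟨l, hl⟩ := q.op_eq_smul_weyl
  refine vec_eq (c := Complex.I ^ k * (Complex.I ^ l * sgn (∑ i, (p.vec i).2 * (q.vec i).1))) ?_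
  rw [op_mul, hk, hl, Matrix.smul_mul, Matrix.mul_smul, weyl_mul, smul_smul, smul_smul, mul_assoc]

@[simp] theorem vec_inv (p : Pauli ι) : p⁻¹.vec = p.vec := by
  have h : p.vec + p⁻¹.vec = 0 := by rw [← vec_mul, mul_inv_cancel, vec_one]
  rw [← zero_add p⁻¹.vec, ← phaseSpace_add_self p.vec, add_assoc, h, add_zero]

theorem op_mul_comm (p q : Pauli ι) :
    p.op * q.op = sgn (sform p.vec q.vec) • (q.op * p.op) := by
  obtain ⟨k, hk⟩ := p.op_eq_smul_weyl
  obtain ⟨l, hl⟩ := q.op_eq_smul_weyl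
  rw [hk, hl, Matrix.smul_mul, Matrix.mul_smul, weyl_comm, Matrix.smul_mul, Matrix.mul_smul]
  simp only [smul_smul]
  congr 1
  ring

theorem star_I_pow_mul (k : ℕ) : star (Complex.I ^ k) * Complex.I ^ k = 1 := by
  rw [star_pow, ← mul_pow]
  simp

theorem conjTranspose_mul_self (p : Pauli ι) : p.opᴴ * p.op = 1 := by
  obtain ⟨k, hk⟩ := p.op_eq_smul_weyl
  rw [hk, Matrix.conjTranspose_smul, weyl_conjTranspose, Matrix.smul_mul, Matrix.mul_smul,
    weyl_transpose_mul_self, smul_smul, star_I_pow_mul, one_smul]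

theorem mul_conjTranspose_self (p : Pauli ι) : p.op * p.opᴴ = 1 :=
  mul_eq_one_comm.mp p.conjTranspose_mul_self

/-- The phase `i` as a Pauli operator. -/
def phase (ι : Type*) [Fintype ι] [DecidableEq ι] : Pauli ι :=
  ⟨⟨Complex.I • 1, -Complex.I • 1, by simp [smul_smul], by simp [smul_smul]⟩,
    Subgroup.subset_closure (Or.inl rfl)⟩

theorem phase_op : (phase ι).op = Complex.I • 1 := rfl

theorem phase_pow_op (k : ℕ) : (phase ι ^ k).op = Complex.I ^ k • 1 := by
  induction k with
  | zero => simp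
  | succ k ih => rw [pow_succ, op_mul, ih, phase_op, Matrix.smul_mul, one_mul, smul_smul, pow_succ]

/-- The condition `hc` makes `M` an involution, so that it is a unit and one of the generators. -/
theorem exists_onQubit (j : ι) (M : Matrix (Fin 2) (Fin 2) ℂ) (c : ℂ) (p : ZMod 2 × ZMod 2)
    (hM : M = c • site p) (hc : c * c * sgn (p.1 * p.2) = 1)
    (h : M = pauliX ∨ M = pauliY ∨ M = pauliZ) : ∃ q : Pauli ι, q.op = onQubit j M := by
  have h1 : onQubit j M * onQubit j M = 1 := by
    rw [hM, onQubit_smul, onQubit_site, Matrix.smul_mul, Matrix.mul_smul, weyl_mul_self,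
      Finset.sum_eq_single j, Pi.single_eq_same, smul_smul, smul_smul, hc, one_smul]
    · intro i _ hi
      simp [Pi.single_eq_of_ne hi]
    · simp
  refine ⟨⟨⟨onQubit j M, onQubit j M, h1, h1⟩, Subgroup.subset_closure (Or.inr ⟨j, ?_⟩)⟩, rfl⟩
  rcases h with rfl | rfl | rfl
  · exact Or.inl rfl
  · exact Or.inr (Or.inl rfl)
  · exact Or.inr (Or.inr rfl)

theorem exists_vec_eq_single (j : ι) (p : ZMod 2 × ZMod 2) :
    ∃ q : Pauli ι, q.vec = Pi.single j p := by
  have key : ∀ (M : Matrix (Fin 2) (Fin 2) ℂ) (c : ℂ), M = c • site p →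
      c * c * sgn (p.1 * p.2) = 1 → (M = pauliX ∨ M = pauliY ∨ M = pauliZ) →
      ∃ q : Pauli ι, q.vec = Pi.single j p := fun M c hM hc h => by
    obtain ⟨q, hq⟩ := exists_onQubit j M c p hM hc h
    exact ⟨q, vec_eq (c := c) (by rw [hq, hM, onQubit_smul, onQubit_site])⟩
  obtain ⟨a, b⟩ := p
  rcases zmod_two_cases a with rfl | rfl <;> rcases zmod_two_cases b with rfl | rfl
  · exact ⟨1, by rw [vec_one]; exact (Pi.single_zero j).symm⟩
  · exact key pauliZ 1 (by rw [pauliZ_eq, one_smul]) (by simp) (by simp)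
  · exact key pauliX 1 (by rw [pauliX_eq, one_smul]) (by simp) (by simp)
  · exact key pauliY Complex.I pauliY_eq (by simp) (by simp)

theorem exists_vec_eq (v : PhaseSpace ι) : ∃ q : Pauli ι, q.vec = v := by
  rw [← Finset.univ_sum_single v]
  refine Finset.sum_induction _ (fun v => ∃ q : Pauli ι, q.vec = v) ?_ ⟨1, vec_one⟩
    fun j _ => exists_vec_eq_single j _
  rintro _ _ ⟨p, rfl⟩ ⟨q, rfl⟩
  exact ⟨p * q, vec_mul p q⟩

/-- Every Weyl operator times a power of `i` is a Pauli operator. -/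
theorem exists_op_eq_smul_weyl (k : ℕ) (v : PhaseSpace ι) :
    ∃ q : Pauli ι, q.op = Complex.I ^ k • weyl v := by
  obtain ⟨q, hq⟩ := exists_vec_eq v
  obtain ⟨l, hl⟩ := q.op_eq_smul_weyl
  refine ⟨phase ι ^ (k + 3 * l) * q, ?_⟩
  rw [op_mul, phase_pow_op, hl, hq, Matrix.smul_mul, one_mul, smul_smul, ← pow_add, add_assoc,
    show 3 * l + l = 4 * l by ring, pow_add, pow_mul, Complex.I_pow_four, one_pow, mul_one]

end Pauli

end PauliWeyl

/-! ## Bipartitions along an equivalence `α ⊕ β ≃ ι` -/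

section Bipartition

variable {ι α β γ : Type*} (e : α ⊕ β ≃ ι)

/-- Join two families along `e`. -/
def glue (x : α → γ) (y : β → γ) : ι → γ := Sum.elim x y ∘ e.symm

@[simp] theorem glue_inl (x : α → γ) (y : β → γ) (i : α) : glue e x y (e (Sum.inl i)) = x i := by
  simp [glue]

@[simp] theorem glue_inr (x : α → γ) (y : β → γ) (j : β) : glue e x y (e (Sum.inr j)) = y j := by
  simp [glue]

theorem forall_along {p : ι → Prop} :
    (∀ l, p l) ↔ (∀ i, p (e (Sum.inl i))) ∧ ∀ j, p (e (Sum.inr j)) := by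
  rw [← e.forall_congr_right, Sum.forall]

theorem glue_restrict (z : ι → γ) :
    glue e (fun i => z (e (Sum.inl i))) (fun j => z (e (Sum.inr j))) = z :=
  funext ((forall_along e).mpr ⟨fun i => by simp, fun j => by simp⟩)

/-- Splitting a family along `e`. -/
def glueEquiv (γ : Type*) : (α → γ) × (β → γ) ≃ (ι → γ) where
  toFun p := glue e p.1 p.2
  invFun z := (fun i => z (e (Sum.inl i)), fun j => z (e (Sum.inr j)))
  left_inv p := by simp
  right_inv z := glue_restrict e z

/-- The restriction of a vector to the first part. -/
def resL : PhaseSpace ι →ₗ[ZMod 2] PhaseSpace α := LinearMap.funLeft _ _ fun i => e (Sum.inl i)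

/-- The restriction of a vector to the second part. -/
def resR : PhaseSpace ι →ₗ[ZMod 2] PhaseSpace β := LinearMap.funLeft _ _ fun j => e (Sum.inr j)

@[simp] theorem resL_glue (u : PhaseSpace α) (v : PhaseSpace β) : resL e (glue e u v) = u :=
  funext fun i => glue_inl e u v i

@[simp] theorem resR_glue (u : PhaseSpace α) (v : PhaseSpace β) : resR e (glue e u v) = v :=
  funext fun j => glue_inr e u v j

/-- The tensor product of two operators along `e`. -/
def tensorAlong (P : QubitOp α) (Q : QubitOp β) : QubitOp ι :=
  Matrix.of fun x y => P (fun i => x (e (Sum.inl i))) (fun i => y (e (Sum.inl i))) *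
    Q (fun j => x (e (Sum.inr j))) (fun j => y (e (Sum.inr j)))

/-- A state read as a linear map from the first part to the second one. -/
def asMap (ψ : (ι → Fin 2) → ℂ) : Matrix (β → Fin 2) (α → Fin 2) ℂ :=
  Matrix.of fun y x => ψ (glue e x y)

theorem asMap_apply (ψ : (ι → Fin 2) → ℂ) (x : α → Fin 2) (y : β → Fin 2) :
    asMap e ψ y x = ψ (glue e x y) := rfl

theorem asMap_injective : Function.Injective (asMap e) := fun ψ φ h => by
  funext z
  have hz := congrFun₂ h (fun j => z (e (Sum.inr j))) (fun i => z (e (Sum.inl i)))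
  rwa [asMap_apply, asMap_apply, glue_restrict] at hz

theorem asMap_smul (c : ℂ) (ψ : (ι → Fin 2) → ℂ) : asMap e (c • ψ) = c • asMap e ψ := rfl

theorem tensorAlong_smul_smul (c d : ℂ) (P : QubitOp α) (Q : QubitOp β) :
    tensorAlong e (c • P) (d • Q) = (c * d) • tensorAlong e P Q := by
  ext x y
  simp [tensorAlong]
  ring

variable [Fintype ι] [Fintype α] [Fintype β]

theorem sum_along {M : Type*} [AddCommMonoid M] (f : ι → M) :
    ∑ l, f l = ∑ i, f (e (Sum.inl i)) + ∑ j, f (e (Sum.inr j)) := by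
  rw [← e.sum_comp, Fintype.sum_sum_type]

theorem prod_along {M : Type*} [CommMonoid M] (f : ι → M) :
    ∏ l, f l = (∏ i, f (e (Sum.inl i))) * ∏ j, f (e (Sum.inr j)) := by
  rw [← e.prod_comp, Fintype.prod_sum_type]

theorem sform_along (u v : PhaseSpace ι) :
    sform u v = sform (resL e u) (resL e v) + sform (resR e u) (resR e v) :=
  sum_along e _

theorem weyl_along (v : PhaseSpace ι) :
    weyl v = tensorAlong e (weyl (resL e v)) (weyl (resR e v)) := by
  ext x y
  exact prod_along e _

/-- For a nondegenerate form, the orthogonal is an order-reversing involution on subspaces, so it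
exchanges meets and joins. -/
theorem sform_inf_orthogonal {L K : Submodule (ZMod 2) (PhaseSpace ι)} :
    sform.orthogonal (L ⊓ K) = sform.orthogonal L ⊔ sform.orthogonal K := by
  have hh : ∀ W, sform.orthogonal (sform.orthogonal W) = W := fun W : Submodule _ (PhaseSpace ι) =>
    LinearMap.BilinForm.orthogonal_orthogonal sform_nondegenerate sform_isRefl W
  rw [← hh (_ ⊔ _)]
  refine congrArg _ (le_antisymm (fun v hv w hw => ?_) (le_inf ?_ ?_))
  · obtain ⟨a, ha, b, hb, rfl⟩ := Submodule.mem_sup.mp hw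
    rw [map_add, LinearMap.add_apply, sform_comm a, sform_comm b, ha v hv.1, hb v hv.2, add_zero]
  · exact (LinearMap.BilinForm.orthogonal_le le_sup_left).trans (hh L).le
  · exact (LinearMap.BilinForm.orthogonal_le le_sup_right).trans (hh K).le

/-- Symplectic reduction: the orthogonal of the reduction of `L` by `K` is contained in the
reduction of the orthogonal of `L` by the orthogonal of `K`. -/
theorem orthogonal_reduction_le (L : Submodule (ZMod 2) (PhaseSpace ι))
    (K : Submodule (ZMod 2) (PhaseSpace α)) :
    sform.orthogonal ((L ⊓ K.comap (resL e)).map (resR e))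
      ≤ (sform.orthogonal L ⊓ (sform.orthogonal K).comap (resL e)).map (resR e) := by
  intro v hv
  -- Extended by zero, `v` pairs with `L ⊓ K.comap (resL e)` only through the second part, so it
  -- splits as `l + q` along the two orthogonals.
  have hu : glue e 0 v ∈ sform.orthogonal (L ⊓ K.comap (resL e)) := fun n hn => by
    rw [sform_along e, resL_glue, resR_glue, map_zero, zero_add]
    exact hv _ (Submodule.mem_map_of_mem hn)
  rw [sform_inf_orthogonal] at hu
  obtain ⟨l, hl, q, hq, h⟩ := Submodule.mem_sup.mp hu
  -- The preimage of `K` contains every vector supported on the second part; being orthogonal to all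
  -- of these, `q` vanishes there.
  have hqR : resR e q = 0 := sform_nondegenerate.2 _ fun w => by
    have := hq (glue e 0 w) (by simp)
    rwa [sform_along e, resL_glue, resR_glue, map_zero, LinearMap.zero_apply, zero_add] at this
  have hqL : resL e q ∈ sform.orthogonal K := fun k hk => by
    have := hq (glue e k 0) (by simpa using hk)
    rwa [sform_along e, resL_glue, resR_glue, map_zero, LinearMap.zero_apply, add_zero] at this
  have hL := congrArg (resL e) h
  have hR := congrArg (resR e) h
  rw [map_add, resL_glue] at hL
  rw [map_add, resR_glue, hqR, add_zero] at hR
  refine ⟨l, ⟨hl, ?_⟩, hR⟩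
  rw [SetLike.mem_coe, Submodule.mem_comap, eq_neg_of_add_eq_zero_left hL]
  exact neg_mem hqL

variable [DecidableEq ι] [DecidableEq α] [DecidableEq β]

theorem sum_glue {M : Type*} [AddCommMonoid M] (f : (ι → Fin 2) → M) :
    ∑ z, f z = ∑ x, ∑ y, f (glue e x y) := by
  rw [← (glueEquiv e (Fin 2)).sum_comp, Fintype.sum_prod_type]
  rfl

theorem tensorAlong_one : tensorAlong e (1 : QubitOp α) (1 : QubitOp β) = 1 := by
  rw [← weyl_zero, ← weyl_zero, ← weyl_zero (ι := ι), weyl_along e, map_zero, map_zero]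

/-- Bending the input legs transposes the operator acting on them. For `P` the conjugate of `a` this
produces the adjoint of `a`, whence the bar in the correspondence. -/
theorem asMap_tensorAlong_mulVec (P : QubitOp α) (Q : QubitOp β) (ψ : (ι → Fin 2) → ℂ) :
    asMap e (tensorAlong e P Q *ᵥ ψ) = Q * asMap e ψ * Pᵀ := by
  ext y x
  rw [asMap_apply, Matrix.mulVec, dotProduct, sum_glue e, Matrix.mul_apply]
  refine Finset.sum_congr rfl fun x' _ => ?_
  rw [Matrix.mul_apply, Finset.sum_mul]
  refine Finset.sum_congr rfl fun y' _ => ?_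
  simp [tensorAlong, asMap_apply]
  ring

theorem tensorAlong_mul (P P' : QubitOp α) (Q Q' : QubitOp β) :
    tensorAlong e P Q * tensorAlong e P' Q' = tensorAlong e (P * P') (Q * Q') := by
  ext x y
  rw [Matrix.mul_apply, sum_glue e]
  simp only [tensorAlong, Matrix.of_apply, Matrix.mul_apply, Finset.sum_mul_sum, glue_inl, glue_inr]
  refine Finset.sum_congr rfl fun x' _ => Finset.sum_congr rfl fun y' _ => by ring

end Bipartition

/-! ## Stabilizer states, up to a factor that may vanish -/

/-- `ψ` is an eigenvector (or zero) of all the Weyl operators in a coisotropic subspace. -/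
def IsStab {ι : Type*} [Fintype ι] [DecidableEq ι] (ψ : (ι → Fin 2) → ℂ) : Prop :=
  ∃ L : Submodule (ZMod 2) (PhaseSpace ι), sform.orthogonal L ≤ L ∧
    ∀ v ∈ L, ∃ c : ℂ, weyl v *ᵥ ψ = c • ψ

/-- Contracting a stabilizer state with a stabilizer state on some of its qubits. -/
theorem IsStab.contract {ι α β : Type*} [Fintype ι] [Fintype α] [Fintype β] [DecidableEq ι]
    [DecidableEq α] [DecidableEq β] (e : α ⊕ β ≃ ι) {ψ : (ι → Fin 2) → ℂ} {φ : (α → Fin 2) → ℂ}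
    (hψ : IsStab ψ) (hφ : IsStab φ) : IsStab (asMap e ψ *ᵥ φ) := by
  obtain ⟨L, hL, hψ⟩ := hψ
  obtain ⟨K, hK, hφ⟩ := hφ
  refine ⟨(L ⊓ K.comap (resL e)).map (resR e), (orthogonal_reduction_le e L K).trans
    (Submodule.map_mono (inf_le_inf hL (Submodule.comap_mono hK))), ?_⟩
  rintro _ ⟨l, ⟨hl, hk⟩, rfl⟩
  obtain ⟨c, hc⟩ := hψ l hl
  obtain ⟨d, hd⟩ := hφ _ hk
  have h := congrArg (asMap e) hc
  rw [weyl_along e, asMap_tensorAlong_mulVec, asMap_smul] at h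
  refine ⟨c * d, ?_⟩
  -- The identity is inserted on the contracted qubits as a Weyl transpose times the Weyl operator:
  -- the first factor is absorbed by `ψ`, the second by `φ`.
  calc weyl (resR e l) *ᵥ (asMap e ψ *ᵥ φ)
      = weyl (resR e l) *ᵥ (asMap e ψ *ᵥ (((weyl (resL e l))ᵀ * weyl (resL e l)) *ᵥ φ)) := by
        rw [weyl_transpose_mul_self, Matrix.one_mulVec]
    _ = (weyl (resR e l) * asMap e ψ * (weyl (resL e l))ᵀ) *ᵥ (weyl (resL e l) *ᵥ φ) := by
        simp only [Matrix.mulVec_mulVec, Matrix.mul_assoc]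
    _ = (c * d) • (asMap e ψ *ᵥ φ) := by
        rw [h, hd, Matrix.smul_mulVec, Matrix.mulVec_smul, smul_smul]

/-! ## The building blocks are stabilizer states -/

theorem sum_bit {ι : Type*} [Fintype ι] (x : ι → Fin 2) :
    ((∑ i, (x i : ℕ) : ℕ) : ZMod 2) = ∑ i, bit (x i) := by
  rw [Nat.cast_sum]
  rfl

theorem flipBit_involutive (t : ZMod 2) : Function.Involutive (flipBit t) := by
  rw [Function.Involutive]
  revert t
  decide

section Blocks

variable {ι : Type*} [Fintype ι] [DecidableEq ι]

theorem IsStab.smul {ψ : (ι → Fin 2) → ℂ} (h : IsStab ψ) (c : ℂ) : IsStab (c • ψ) := by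
  obtain ⟨L, hL, h⟩ := h
  refine ⟨L, hL, fun v hv => ?_⟩
  obtain ⟨d, hd⟩ := h v hv
  exact ⟨d, by rw [Matrix.mulVec_smul, hd, smul_comm]⟩

/-- The basis state with all labels zero. -/
theorem isStab_basis : IsStab (Pi.single (0 : ι → Fin 2) (1 : ℂ)) := by
  let L : Submodule (ZMod 2) (PhaseSpace ι) :=
    { carrier := {v | ∀ i, (v i).1 = 0}
      add_mem' := fun {u v} hu hv i => by simp [hu i, hv i]
      zero_mem' := fun i => rfl
      smul_mem' := fun c v hv i => by simp [hv i] }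
  refine ⟨L, fun v hv i => ?_, fun v hv => ⟨1, ?_⟩⟩
  · have h := hv (Pi.single i (0, 1)) fun j => by
      rcases eq_or_ne j i with rfl | hj
      · simp
      · simp [Pi.single_eq_of_ne hj]
    simpa [sform_single_left] using h
  · funext x
    have hv' : ∀ i, (v i).1 = 0 := hv
    simp only [weyl_mulVec, hv', flipBit_zero, add_zero, one_smul]
    rcases eq_or_ne x 0 with rfl | hx
    · simp only [Pi.zero_apply, mul_zero, bit_zero, sgn_zero, Finset.prod_const_one, one_mul]
      congr 1
    · simp [Pi.single_eq_of_ne hx]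

theorem natCast_mod_two_eq_iff (m : ℕ) (s : Fin 2) : m % 2 = s ↔ (m : ZMod 2) = bit s := by
  rw [bit, ZMod.natCast_eq_natCast_iff', Nat.mod_eq_of_lt s.is_lt]

/-- Flipping the bit turns `d ^ x` into a multiple of `sgn g ^ x * d ^ x`, because `d` squares to
`sgn g`. The factor `Z ^ (g * a)` undoes this sign, and only `Z ^ t` remains. -/
theorem exists_weight_flip {g : ZMod 2} {d : ℂ} (hd : d * d = sgn g) (t a : ZMod 2) :
    ∃ c : ℂ, ∀ x : Fin 2, sgn ((t + g * a) * (bit x + a)) * d ^ (flipBit a x : ℕ)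
      = c * (sgn (t * bit x) * d ^ (x : ℕ)) := by
  rcases zmod_two_cases a with rfl | rfl
  · exact ⟨1, fun x => by simp⟩
  · refine ⟨sgn t * sgn g * d, fun x => ?_⟩
    fin_cases x
    · simp [sgn_add]
    · simp only [Fin.mk_one, bit_one, flipBit_one_one, add_self_zmod_two, mul_zero, sgn_zero,
        mul_one, Fin.val_zero, pow_zero, pow_one]
      linear_combination (-(sgn t * sgn t * sgn g)) * hd - sgn_mul_self t
        - sgn t * sgn t * sgn_mul_self g

/-- The weighted parity states: red and green spiders. -/
theorem isStab_parity {d : ι → ℂ} {g : ι → ZMod 2} (hd : ∀ i, d i * d i = sgn (g i)) (s : ZMod 2) :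
    IsStab fun x : ι → Fin 2 => if ∑ i, bit (x i) = s then ∏ i, d i ^ (x i : ℕ) else 0 := by
  -- Spanned by `Z` on all sites, which measures the parity, and by pairs of flips, which preserve
  -- it, each flip dressed with `Z ^ g i`.
  let L : Submodule (ZMod 2) (PhaseSpace ι) :=
    { carrier := {v | ∑ i, (v i).1 = 0 ∧ ∃ t, ∀ i, (v i).2 = t + g i * (v i).1}
      add_mem' := by
        rintro u v ⟨hu, t, ht⟩ ⟨hv, t', ht'⟩
        refine ⟨by simp [Finset.sum_add_distrib, hu, hv], t + t', fun i => ?_⟩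
        simp [ht, ht']
        ring
      zero_mem' := ⟨by simp, 0, by simp⟩
      smul_mem' := by
        rintro c v ⟨hv, t, ht⟩
        refine ⟨by simp [← Finset.mul_sum, hv], c * t, fun i => ?_⟩
        simp [ht]
        ring }
  refine ⟨L, fun u hu => ⟨?_, ?_⟩, fun v hv => ?_⟩
  · have h := hu (fun _ => (0, 1)) ⟨by simp, 1, by simp⟩
    simpa [sform_apply] using h
  · have h : ∀ i j, (u i).2 + g i * (u i).1 = (u j).2 + g j * (u j).1 := fun i j => by
      -- Testing against a dressed pair of flips at `i` and `j` compares the candidates for `t` at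
      -- these two sites.
      let c : ι → ZMod 2 := Pi.single i 1 + Pi.single j 1
      have h := hu (fun k => (c k, g k * c k))
        ⟨by simp [c, Finset.sum_add_distrib, add_self_zmod_two], 0, by simp⟩
      have h' : sform (fun k => (c k, g k * c k)) u = ∑ k, c k * ((u k).2 + g k * (u k).1) := by
        rw [sform_apply]
        congr! 1
        ring
      rw [h'] at h
      simp only [c, Pi.add_apply, add_mul, Finset.sum_add_distrib, Pi.single_apply, ite_mul,
        one_mul, zero_mul, Finset.sum_ite_eq', Finset.mem_univ, if_true] at h
      exact CharTwo.add_eq_zero.mp h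
    rcases isEmpty_or_nonempty ι with h0 | ⟨⟨i⟩⟩
    · exact ⟨0, fun i => h0.elim i⟩
    · refine ⟨(u i).2 + g i * (u i).1, fun j => ?_⟩
      rw [h i j, add_assoc, add_self_zmod_two, add_zero]
  · obtain ⟨hv, t, ht⟩ := hv
    choose c hc using fun i => exists_weight_flip (hd i) t (v i).1
    refine ⟨(∏ i, c i) * sgn (t * s), ?_⟩
    funext x
    rw [weyl_mulVec, Pi.smul_apply, smul_eq_mul]
    simp only [bit_flipBit, Finset.sum_add_distrib, hv, add_zero]
    split_ifs with hs
    · rw [← hs, Finset.mul_sum, sgn_sum, ← Finset.prod_mul_distrib, ← Finset.prod_mul_distrib,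
        ← Finset.prod_mul_distrib]
      refine Finset.prod_congr rfl fun i _ => ?_
      rw [ht, hc, mul_assoc]
    · simp

/-- The signed cat states: blue spiders. -/
theorem isStab_cat (s : ZMod 2) :
    IsStab fun x : ι → Fin 2 => ∑ a : Fin 2, if ∀ i, x i = a then sgn (s * bit a) else 0 := by
  -- Spanned by `X` on all sites and by pairs of `Z`.
  let L : Submodule (ZMod 2) (PhaseSpace ι) :=
    { carrier := {v | ∑ i, (v i).2 = 0 ∧ ∃ t, ∀ i, (v i).1 = t}
      add_mem' := by
        rintro u v ⟨hu, t, ht⟩ ⟨hv, t', ht'⟩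
        exact ⟨by simp [Finset.sum_add_distrib, hu, hv], t + t', fun i => by simp [ht, ht']⟩
      zero_mem' := ⟨by simp, 0, by simp⟩
      smul_mem' := by
        rintro c v ⟨hv, t, ht⟩
        exact ⟨by simp [← Finset.mul_sum, hv], c * t, fun i => by simp [ht]⟩ }
  refine ⟨L, fun u hu => ⟨?_, ?_⟩, fun v hv => ?_⟩
  · have h := hu (fun _ => (1, 0)) ⟨by simp, 1, by simp⟩
    simpa [sform_apply] using h
  · have h : ∀ i j, (u i).1 = (u j).1 := fun i j => by
      let c : ι → ZMod 2 := Pi.single i 1 + Pi.single j 1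
      have h := hu (fun k => (0, c k))
        ⟨by simp [c, Finset.sum_add_distrib, add_self_zmod_two], 0, by simp⟩
      simp only [sform_apply, zero_mul, zero_add, c, Pi.add_apply, add_mul,
        Finset.sum_add_distrib, Pi.single_apply, ite_mul, one_mul, Finset.sum_ite_eq',
        Finset.mem_univ, if_true] at h
      exact CharTwo.add_eq_zero.mp h
    rcases isEmpty_or_nonempty ι with h0 | ⟨⟨i⟩⟩
    · exact ⟨0, fun i => h0.elim i⟩
    · exact ⟨(u i).1, fun j => h j i⟩
  · obtain ⟨hv, t, ht⟩ := hv
    refine ⟨sgn (s * t), ?_⟩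
    funext x
    have hinv := flipBit_involutive t
    -- Flipping all sites flips the common label, so the sum over that label is reindexed.
    rw [weyl_mulVec, Pi.smul_apply, smul_eq_mul, ← Equiv.sum_comp (hinv.toPerm _), Finset.mul_sum,
      Finset.mul_sum]
    refine Finset.sum_congr rfl fun a _ => ?_
    simp only [Function.Involutive.coe_toPerm, ht, hinv.injective.eq_iff, bit_flipBit]
    split_ifs with h
    · simp only [h]
      rw [← sgn_sum, ← Finset.sum_mul, hv, zero_mul, sgn_zero, one_mul, mul_add, sgn_add, mul_comm]
    · simp

theorem graph_sign (g a b y z : ZMod 2) :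
    b * (y + a) + (a + g * b) * (z + b) + (y + a) * (z + b)
      = y * z + a * b + g * b * (z + b) := by
  revert g a b y z
  decide

/-- The weighted two-qubit graph states: basis changes. -/
theorem isStab_graph {d : ℂ} {g : ZMod 2} (hd : d * d = sgn g) :
    IsStab fun x : Fin 2 → Fin 2 => sgn (bit (x 0) * bit (x 1)) * d ^ (x 1 : ℕ) := by
  -- Spanned by `X ⊗ Z` and `Z ⊗ X Z ^ g`, the graph state generators corrected for the weight;
  -- these are also the test vectors below.
  let L : Submodule (ZMod 2) (PhaseSpace (Fin 2)) :=
    { carrier := {v | (v 0).2 = (v 1).1 ∧ (v 1).2 = (v 0).1 + g * (v 1).1}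
      add_mem' := by
        rintro u v ⟨hu, hu'⟩ ⟨hv, hv'⟩
        refine ⟨by simp [hu, hv], ?_⟩
        simp [hu', hv']
        ring
      zero_mem' := by simp
      smul_mem' := by
        rintro c v ⟨hv, hv'⟩
        refine ⟨by simp [hv], ?_⟩
        simp [hv']
        ring }
  refine ⟨L, fun u hu => ⟨?_, ?_⟩, fun v hv => ?_⟩
  · have h := hu ![(1, 0), (0, 1)] ⟨by simp, by simp⟩
    simp [sform_apply, Fin.sum_univ_two] at h
    exact CharTwo.add_eq_zero.mp h
  · have h := hu ![(0, 1), (1, g)] ⟨by simp, by simp⟩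
    simp [sform_apply, Fin.sum_univ_two] at h
    rw [add_left_comm] at h
    exact CharTwo.add_eq_zero.mp h
  · obtain ⟨h0, h1⟩ := hv
    obtain ⟨c, hc⟩ := exists_weight_flip hd 0 (v 1).1
    refine ⟨c * sgn ((v 0).1 * (v 1).1), ?_⟩
    funext x
    have hx := hc (x 1)
    rw [zero_add, zero_mul, sgn_zero, one_mul] at hx
    rw [weyl_mulVec, Pi.smul_apply, smul_eq_mul, Fin.prod_univ_two, h0, h1, bit_flipBit,
      bit_flipBit, ← sgn_add, ← mul_assoc, ← sgn_add]
    calc _ = sgn (bit (x 0) * bit (x 1) + (v 0).1 * (v 1).1) *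
          (sgn (g * (v 1).1 * (bit (x 1) + (v 1).1)) * d ^ (flipBit (v 1).1 (x 1) : ℕ)) := by
          rw [← mul_assoc, ← sgn_add]
          congr 2
          exact graph_sign _ _ _ _ _
      _ = _ := by
          rw [hx, sgn_add]
          ring

end Blocks

/-! ## Tensor networks are stabilizer states -/

theorem IsStab.congr {ι : Type*} [Fintype ι] [DecidableEq ι] {ψ φ : (ι → Fin 2) → ℂ} (h : IsStab ψ)
    (hφ : ∀ x, φ x = ψ x) : IsStab φ := by
  rwa [show φ = ψ from funext hφ]

/-- Red, green and phase blocks are parity states with weights `1`, `±i` and `(i, 1)`; blue ones are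
cat states. The two Hadamard-like blocks are graph states of weight `1` and `i`. -/
theorem RGBBlock.isStab_tensor (t : RGBBlock) : IsStab t.tensor := by
  cases t with
  | red n s =>
    have h := isStab_parity (ι := Fin n) (d := fun _ => 1) (g := fun _ => 0) (by simp) (bit s)
    refine h.congr fun x => ?_
    simp [RGBBlock.tensor, natCast_mod_two_eq_iff, ← sum_bit]
  | green n s flip =>
    have h := isStab_parity (ι := Fin n) (d := fun i => if flip i then -Complex.I else Complex.I)
      (g := fun _ => 1) (fun i => by split_ifs <;> simp) (bit s)
    refine h.congr fun x => ?_
    simp [RGBBlock.tensor, natCast_mod_two_eq_iff, ← sum_bit]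
  | blue n s =>
    have h := isStab_cat (ι := Fin n) (bit s)
    refine h.congr fun x => ?_
    refine Finset.sum_congr rfl fun a _ => ?_
    simp only [← Fin.ext_iff]
    congr 1
    fin_cases s <;> fin_cases a <;> simp
  | hadamard =>
    have h := (isStab_graph (d := 1) (g := 0) (by simp)).smul ((Real.sqrt 2 : ℝ) : ℂ)⁻¹
    refine h.congr fun x => ?_
    rw [Pi.smul_apply, smul_eq_mul]
    simp only [RGBBlock.tensor, one_pow, mul_one]
    congr 1
    generalize x (0 : Fin 2) = a
    generalize x (1 : Fin 2) = b
    fin_cases a <;> fin_cases b <;> simp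
  | phase =>
    have h := isStab_parity (ι := Fin 2) (d := ![Complex.I, 1]) (g := ![1, 0])
      (fun i => by fin_cases i <;> simp) 0
    refine h.congr fun x => ?_
    simp only [RGBBlock.tensor, Fin.sum_univ_two, Fin.prod_univ_two]
    generalize x (0 : Fin 2) = a
    generalize x (1 : Fin 2) = b
    fin_cases a <;> fin_cases b <;> simp [add_self_zmod_two]
  | hadamardPhase =>
    have h := (isStab_graph (d := Complex.I) (g := 1) (by simp)).smul ((Real.sqrt 2 : ℝ) : ℂ)⁻¹
    refine h.congr fun x => ?_
    rw [Pi.smul_apply, smul_eq_mul]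
    simp only [RGBBlock.tensor]
    congr 1
    generalize x (0 : Fin 2) = a
    generalize x (1 : Fin 2) = b
    fin_cases a <;> fin_cases b <;> simp [pow_succ]

/-- Products of stabilizer states. -/
theorem IsStab.prod {V : Type*} [Fintype V] [DecidableEq V] {κ : V → Type*} [∀ v, Fintype (κ v)]
    [∀ v, DecidableEq (κ v)] {ψ : ∀ v, (κ v → Fin 2) → ℂ} (h : ∀ v, IsStab (ψ v)) :
    IsStab fun x : (Σ v, κ v) → Fin 2 => ∏ v, ψ v fun i => x ⟨v, i⟩ := by
  choose L hL hψ using h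
  let r : ∀ v, PhaseSpace (Σ v, κ v) →ₗ[ZMod 2] PhaseSpace (κ v) := fun v =>
    LinearMap.funLeft _ _ fun i => ⟨v, i⟩
  refine ⟨⨅ v, (L v).comap (r v), fun u hu => ?_, fun u hu => ?_⟩
  · refine (Submodule.mem_iInf _).mpr fun v => hL v fun w hw => ?_
    let w' : PhaseSpace (Σ v, κ v) := fun l => (Pi.single v w : ∀ v, PhaseSpace (κ v)) l.1 l.2
    have hw' : ∀ v', r v' w' = (Pi.single v w : ∀ v, PhaseSpace (κ v)) v' := fun v' => rfl
    have h := hu w' <| (Submodule.mem_iInf _).mpr fun v' => by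
      rw [Submodule.mem_comap, hw']
      rcases eq_or_ne v' v with rfl | hv
      · rwa [Pi.single_eq_same]
      · rw [Pi.single_eq_of_ne hv]
        exact zero_mem _
    have hs : sform w' u = ∑ v', sform (r v' w') (r v' u) := Fintype.sum_sigma _
    rw [hs, Finset.sum_eq_single v] at h
    · rwa [hw', Pi.single_eq_same] at h
    · intro v' _ hv
      rw [hw', Pi.single_eq_of_ne hv, map_zero, LinearMap.zero_apply]
    · simp
  · choose c hc using fun v => hψ v (r v u) ((Submodule.mem_iInf _).mp hu v)
    refine ⟨∏ v, c v, ?_⟩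
    funext x
    rw [weyl_mulVec, Pi.smul_apply, smul_eq_mul, Fintype.prod_sigma, ← Finset.prod_mul_distrib,
      ← Finset.prod_mul_distrib]
    refine Finset.prod_congr rfl fun v _ => ?_
    have hv := congrFun (hc v) fun i => x ⟨v, i⟩
    rwa [weyl_mulVec] at hv

/-- Products of Bell pairs. -/
theorem isStab_bell {α : Type*} [Fintype α] [DecidableEq α] {σ : α → α}
    (hσ : ∀ l, σ (σ l) = l) (hne : ∀ l, σ l ≠ l) :
    IsStab fun y : α → Fin 2 => if ∀ l, y (σ l) = y l then (1 : ℂ) else 0 := by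
  let L : Submodule (ZMod 2) (PhaseSpace α) :=
    { carrier := {v | ∀ l, v (σ l) = v l}
      add_mem' := fun {u v} hu hv l => by simp [hu l, hv l]
      zero_mem' := fun l => rfl
      smul_mem' := fun c v hv l => by simp [hv l] }
  refine ⟨L, fun v hv l => ?_, fun v hv => ⟨1, ?_⟩⟩
  · refine sub_eq_zero.mp (eq_zero_of_site_form fun p => ?_)
    -- Equal exponents at both ends of an edge give an element of `L`, which forces `v` to agree at
    -- these ends.
    have h := hv (Pi.single l p + Pi.single (σ l) p) fun k => by
      have h1 : σ k = l ↔ k = σ l := ⟨fun h => by rw [← h, hσ], fun h => by rw [h, hσ]⟩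
      have h2 : σ k = σ l ↔ k = l := ⟨fun h => by rw [← hσ k, h, hσ], fun h => by rw [h]⟩
      simp only [Pi.add_apply, Pi.single_apply, h1, h2]
      exact add_comm _ _
    rw [map_add, LinearMap.add_apply, sform_single_left, sform_single_left] at h
    simp only [Prod.fst_sub, Prod.snd_sub, CharTwo.sub_eq_add]
    linear_combination h
  · have hv' : ∀ l, v (σ l) = v l := hv
    funext x
    simp only [weyl_mulVec, hv', one_smul, (flipBit_involutive _).injective.eq_iff]
    split_ifs with hx
    · rw [mul_one]
      -- The ends of an edge are distinct and contribute equal signs, which cancel.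
      refine Finset.prod_involution (fun l _ => σ l) (fun l _ => ?_) (fun l _ _ => hne l)
        (fun l _ => Finset.mem_univ _) (fun l _ => hσ l)
      rw [hv', hx, sgn_mul_self]
    · rw [mul_zero]

/-! ### A network as a single contraction -/

namespace RGBNetwork

variable {V : Type*} [Fintype V] [DecidableEq V] (T : RGBNetwork V)

/-- The two ends of the contracted edges. -/
abbrev ClosedLeg := {l : T.Leg // ¬T.link l = l}

/-- The legs are the closed and the open ones. -/
def legEquiv : T.ClosedLeg ⊕ T.OpenLeg ≃ T.Leg :=
  (Equiv.sumComm _ _).trans (Equiv.sumCompl fun l => T.link l = l)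

/-- The involution on the closed legs. -/
def closedLink (l : T.ClosedLeg) : T.ClosedLeg :=
  ⟨T.link l, fun h => l.2 (by rwa [T.link_link, eq_comm] at h)⟩

/-- The constraints along all contracted edges together form one vector of Bell pairs on the closed
legs, so `IsStab.contract` is needed only once. -/
theorem tensor_eq : T.tensor = asMap T.legEquiv (fun y => ∏ v, (T.block v).tensor fun i => y ⟨v, i⟩)
    *ᵥ fun z => if ∀ l, z (T.closedLink l) = z l then 1 else 0 := by
  funext x
  rw [Matrix.mulVec, dotProduct, tensor, sum_glue T.legEquiv]
  refine Finset.sum_congr rfl fun z _ => ?_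
  have hopen : ∀ (x' : T.OpenLeg → Fin 2) (l : T.OpenLeg), glue T.legEquiv z x' l = x' l :=
    fun x' l => glue_inr T.legEquiv z x' l
  have hclosed : ∀ (x' : T.OpenLeg → Fin 2) (l : T.ClosedLeg), glue T.legEquiv z x' l = z l :=
    fun x' l => glue_inl T.legEquiv z x' l
  rw [Finset.sum_eq_single x]
  · have h : ((∀ l, glue T.legEquiv z x (T.link l) = glue T.legEquiv z x l) ∧
        ∀ l : T.OpenLeg, glue T.legEquiv z x l = x l) ↔ ∀ l, z (T.closedLink l) = z l := by
      refine ⟨fun h l => ?_, fun h => ⟨fun l => ?_, hopen x⟩⟩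
      · rw [← hclosed x, ← hclosed x]
        exact h.1 l
      · by_cases hl : T.link l = l
        · rw [hl]
        · exact (hclosed x (T.closedLink ⟨l, hl⟩)).trans ((h ⟨l, hl⟩).trans (hclosed x ⟨l, hl⟩).symm)
    simp only [h, asMap_apply, mul_ite, mul_one, mul_zero]
  · intro x' _ hx
    refine if_neg fun h => hx (funext fun l => ?_)
    rw [← hopen x', h.2]
  · simp

theorem isStab_tensor : IsStab T.tensor := by
  rw [tensor_eq]
  refine IsStab.contract _ (IsStab.prod fun v => (T.block v).isStab_tensor)
    (isStab_bell (fun l => Subtype.ext (T.link_link l)) fun l h => l.2 (congrArg Subtype.val h))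

end RGBNetwork

/-! ## Stabilizer groups -/

section StabilizerGroup

variable {ι : Type*} [Fintype ι] [DecidableEq ι]

theorem Pauli.op_mul_weyl (p : Pauli ι) (v : PhaseSpace ι) :
    p.op * weyl v = sgn (sform p.vec v) • (weyl v * p.op) := by
  obtain ⟨k, hk⟩ := p.op_eq_smul_weyl
  rw [hk, Matrix.smul_mul, Matrix.mul_smul, weyl_comm, smul_comm]

theorem Pauli.eq_or_of_vec_eq_zero {p : Pauli ι} (h : p.vec = 0) :
    p = 1 ∨ p.op = -1 ∨ (p * p).op = -1 := by
  obtain ⟨k, hk⟩ := p.op_eq_smul_weyl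
  rw [h, weyl_zero] at hk
  have h2 : (p * p).op = Complex.I ^ (k + k) • 1 := by
    rw [op_mul, hk, Matrix.smul_mul, one_mul, smul_smul, ← pow_add]
  rcases Nat.even_or_odd' k with ⟨m, rfl | rfl⟩
  · rw [pow_mul, Complex.I_sq] at hk
    rcases neg_one_pow_eq_or ℂ m with h | h
    · exact Or.inl (op_injective (by rw [hk, h, one_smul, op_one]))
    · exact Or.inr (Or.inl (by rw [hk, h, neg_one_smul]))
  · refine Or.inr (Or.inr ?_)
    rw [h2, show 2 * m + 1 + (2 * m + 1) = 4 * m + 2 by ring, pow_add, pow_mul,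
      Complex.I_pow_four, one_pow, one_mul, Complex.I_sq, neg_one_smul]

theorem Pauli.mul_comm_iff {p q : Pauli ι} : p * q = q * p ↔ sform p.vec q.vec = 0 := by
  refine ⟨fun hpq => ?_, fun h => op_injective ?_⟩
  · by_contra hne
    have h1 := op_mul_comm p q
    rw [(zmod_two_cases _).resolve_left hne, sgn_one, neg_one_smul, ← op_mul, ← op_mul,
      ← hpq] at h1
    have h2 : (p * q).op = 0 := Matrix.ext fun x y => self_eq_neg.mp (congrFun₂ h1 x y)
    have h3 := op_mul_inv (p * q)
    rw [h2, zero_mul] at h3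
    exact absurd h3 zero_ne_one
  · rw [op_mul, op_mul_comm, h, sgn_zero, one_smul, op_mul]

/-- The exponents of the elements of a group of Pauli operators. -/
def vecs (S : Subgroup (Pauli ι)) : Submodule (ZMod 2) (PhaseSpace ι) where
  carrier := {v | ∃ p ∈ S, p.vec = v}
  add_mem' := by
    rintro _ _ ⟨p, hp, rfl⟩ ⟨q, hq, rfl⟩
    exact ⟨p * q, mul_mem hp hq, Pauli.vec_mul p q⟩
  zero_mem' := ⟨1, one_mem S, Pauli.vec_one⟩
  smul_mem' := by
    rintro c _ ⟨p, hp, rfl⟩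
    rcases zmod_two_cases c with rfl | rfl
    · exact ⟨1, one_mem S, by rw [zero_smul, Pauli.vec_one]⟩
    · exact ⟨p, hp, by rw [one_smul]⟩

namespace IsStabilizerGroup

variable {S : Subgroup (Pauli ι)}

/-- The quotient of the two is a power of `i` in `S`. It cannot be `-1`, nor `±i`, whose square is
`-1`. -/
theorem eq_of_vec_eq (hS : IsStabilizerGroup S) {p q : Pauli ι} (hp : p ∈ S) (hq : q ∈ S)
    (h : p.vec = q.vec) : p = q := by
  have hpq : p * q⁻¹ ∈ S := mul_mem hp (inv_mem hq)
  have hv : (p * q⁻¹).vec = 0 := by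
    rw [Pauli.vec_mul, Pauli.vec_inv, h, phaseSpace_add_self]
  rcases Pauli.eq_or_of_vec_eq_zero hv with h1 | h1 | h1
  · exact mul_inv_eq_one.mp h1
  · exact absurd h1 (hS.neg_one_notMem _ hpq)
  · exact absurd h1 (hS.neg_one_notMem _ (mul_mem hpq hpq))

theorem vec_injective (hS : IsStabilizerGroup S) :
    Function.Injective fun s : S => (s : Pauli ι).vec :=
  fun s t h => Subtype.ext (hS.eq_of_vec_eq s.2 t.2 h)

theorem finite (hS : IsStabilizerGroup S) : Finite S := Finite.of_injective _ hS.vec_injective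

/-- On `S`, `Pauli.vec` is injective and turns products into sums, so generating sets of `S` match
spanning sets of `vecs S`. -/
theorem hasRank (hS : IsStabilizerGroup S) : HasRank S (Module.finrank (ZMod 2) (vecs S)) := by
  classical
  constructor
  · let b := Module.finBasis (ZMod 2) (vecs S)
    choose p hpS hp using fun i => (b i).2
    have hinj : Function.Injective p := fun i j h => b.injective <| Subtype.ext <| by
      rw [← hp, ← hp, h]
    refine ⟨Finset.univ.image p, ?_, ?_⟩
    · rw [Finset.card_image_of_injective _ hinj, Finset.card_univ, Fintype.card_fin]
    · have hle : Subgroup.closure ((Finset.univ.image p : Finset (Pauli ι)) : Set (Pauli ι)) ≤ S :=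
        (Subgroup.closure_le S).mpr fun q hq => by
          obtain ⟨i, -, rfl⟩ := Finset.mem_image.mp (Finset.mem_coe.mp hq)
          exact hpS i
      refine le_antisymm hle fun s hs => ?_
      have hvecs : vecs S ≤ vecs (Subgroup.closure
          ((Finset.univ.image p : Finset (Pauli ι)) : Set (Pauli ι))) := by
        have h := congrArg (Submodule.map (vecs S).subtype) b.span_eq
        rw [Submodule.map_span, Submodule.map_subtype_top] at h
        refine h.ge.trans (Submodule.span_le.mpr ?_)
        rintro _ ⟨_, ⟨i, rfl⟩, rfl⟩
        exact ⟨p i, Subgroup.subset_closure (by simp), hp i⟩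
      obtain ⟨q, hq, hqs⟩ := hvecs ⟨s, hs, rfl⟩
      rwa [← hS.eq_of_vec_eq (hle hq) hs hqs]
  · rintro _ ⟨g, rfl, hg⟩
    have hspan : vecs S ≤ Submodule.span (ZMod 2) (g.image Pauli.vec : Finset (PhaseSpace ι)) := by
      rintro _ ⟨s, hs, rfl⟩
      rw [← hg] at hs
      induction hs using Subgroup.closure_induction with
      | mem q hq => exact Submodule.subset_span (Finset.mem_coe.mpr (Finset.mem_image_of_mem _ hq))
      | one => rw [Pauli.vec_one]; exact zero_mem _
      | mul p q _ _ hp hq => rw [Pauli.vec_mul]; exact add_mem hp hq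
      | inv p _ hp => rwa [Pauli.vec_inv]
    exact (Submodule.finrank_mono hspan).trans
      ((finrank_span_finset_le_card _).trans Finset.card_image_le)

theorem vecs_le_orthogonal (hS : IsStabilizerGroup S) : vecs S ≤ sform.orthogonal (vecs S) := by
  rintro _ ⟨p, hp, rfl⟩ _ ⟨q, hq, rfl⟩
  exact Pauli.mul_comm_iff.mp (hS.comm q hq p hp)

theorem finrank_vecs (hS : IsStabilizerGroup S) (h : sform.orthogonal (vecs S) ≤ vecs S) :
    Module.finrank (ZMod 2) (vecs S) = Fintype.card ι := by
  have h1 := LinearMap.BilinForm.finrank_orthogonal (sform_nondegenerate (ι := ι)) (vecs S)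
  rw [le_antisymm h hS.vecs_le_orthogonal] at h1
  have h2 := Submodule.finrank_le (vecs S)
  have h3 : Module.finrank (ZMod 2) (PhaseSpace ι) = Fintype.card ι * 2 := by
    simp [PhaseSpace, Module.finrank_pi_fintype]
  omega

/-- An operator fixed by `S`, all of whose other Weyl coefficients vanish by symmetry, is a
multiple of the sum over `S`. -/
theorem smul_eq_trace_smul_finsum (hS : IsStabilizerGroup S) {ρ : QubitOp ι}
    (h1 : ∀ p ∈ S, p.op * ρ = ρ)
    (h2 : ∀ v ∉ vecs S, ∃ p : Pauli ι, p.op * ρ = ρ * p.op ∧ sform p.vec v ≠ 0) :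
    (2 ^ Fintype.card ι : ℂ) • ρ = ρ.trace • ∑ᶠ s : S, (s : Pauli ι).op := by
  have := hS.finite
  have := Fintype.ofFinite S
  rw [weyl_expansion, finsum_eq_sum_of_fintype, Finset.smul_sum]
  refine (Fintype.sum_of_injective _ hS.vec_injective _ _ (fun v hv => ?_) fun s => ?_).symm
  -- Here `p` commutes with `ρ` and anticommutes with `weyl v`; conjugating by it shows that the
  -- coefficient equals its own negative.
  · obtain ⟨p, hp, hpv⟩ := h2 v fun ⟨s, hs, hsv⟩ => hv ⟨⟨s, hs⟩, hsv⟩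
    have h3 : p.op * (weyl v)ᵀ = -((weyl v)ᵀ * p.op) := by
      rw [weyl_transpose, Matrix.mul_smul, p.op_mul_weyl,
        (zmod_two_cases _).resolve_left hpv, sgn_one, neg_one_smul, smul_neg, Matrix.smul_mul]
    have h4 : ((weyl v)ᵀ * ρ).trace = -((weyl v)ᵀ * ρ).trace := by
      calc ((weyl v)ᵀ * ρ).trace = ((p.op * ((weyl v)ᵀ * ρ)) * p⁻¹.op).trace := by
            rw [Matrix.trace_mul_comm _ p⁻¹.op, ← Matrix.mul_assoc, p.op_inv_mul, one_mul]
        _ = -((weyl v)ᵀ * ρ).trace := by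
            rw [← Matrix.mul_assoc p.op, h3, Matrix.neg_mul, Matrix.mul_assoc _ p.op, hp,
              ← Matrix.mul_assoc, Matrix.neg_mul, Matrix.mul_assoc _ p.op, p.op_mul_inv, mul_one,
              Matrix.trace_neg]
    rw [self_eq_neg.mp h4, zero_smul]
  · obtain ⟨k, hk⟩ := (s : Pauli ι).op_eq_smul_weyl
    have h3 : (weyl (s : Pauli ι).vec)ᵀ * ρ = Complex.I ^ k • ρ := by
      conv_lhs => rw [← h1 s s.2]
      rw [hk, Matrix.smul_mul, Matrix.mul_smul, ← Matrix.mul_assoc, weyl_transpose_mul_self,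
        one_mul]
    rw [h3, hk, Matrix.trace_smul, smul_smul, smul_eq_mul, mul_comm]

end IsStabilizerGroup

/-! ## The stabilizer group of a state -/

/-- The Pauli operators that fix `ψ`. -/
def stabGroup (ψ : (ι → Fin 2) → ℂ) : Subgroup (Pauli ι) where
  carrier := {p | p.op *ᵥ ψ = ψ}
  mul_mem' := fun {p q} (hp : _ = _) (hq : _ = _) => by
    change _ = _
    rw [Pauli.op_mul, ← Matrix.mulVec_mulVec, hq, hp]
  one_mem' := by
    change _ = _
    rw [Pauli.op_one, Matrix.one_mulVec]
  inv_mem' := fun {p} (hp : _ = _) => by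
    change _ = _
    conv_lhs => rw [← hp]
    rw [Matrix.mulVec_mulVec, p.op_inv_mul, Matrix.one_mulVec]

theorem mem_stabGroup {ψ : (ι → Fin 2) → ℂ} {p : Pauli ι} :
    p ∈ stabGroup ψ ↔ p.op *ᵥ ψ = ψ := Iff.rfl

variable {ψ : (ι → Fin 2) → ℂ}

theorem isStabilizerGroup_stabGroup (h0 : ψ ≠ 0) : IsStabilizerGroup (stabGroup ψ) where
  comm p hp q hq := by
    rcases zmod_two_cases (sform p.vec q.vec) with h | h
    · exact Pauli.mul_comm_iff.mpr h
    · have h1 := mem_stabGroup.mp (mul_mem hp hq)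
      rw [Pauli.op_mul, Pauli.op_mul_comm, h, sgn_one, neg_one_smul, Matrix.neg_mulVec,
        ← Pauli.op_mul, mem_stabGroup.mp (mul_mem hq hp)] at h1
      exact absurd (neg_eq_self.mp h1) h0
  neg_one_notMem p hp h := by
    have h1 := mem_stabGroup.mp hp
    rw [h, Matrix.neg_mulVec, Matrix.one_mulVec] at h1
    exact h0 (neg_eq_self.mp h1)

theorem exists_I_pow_mul_eq_one {c : ℂ} {a : ZMod 2} (h : c * c = sgn a) :
    ∃ k : ℕ, Complex.I ^ k * c = 1 := by
  rcases zmod_two_cases a with rfl | rfl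
  · rw [sgn_zero, mul_self_eq_one_iff] at h
    rcases h with rfl | rfl
    · exact ⟨0, by simp⟩
    · exact ⟨2, by simp⟩
  · rw [sgn_one, ← Complex.I_mul_I, mul_self_eq_mul_self_iff] at h
    rcases h with rfl | rfl
    · exact ⟨3, by rw [← pow_succ, Complex.I_pow_four]⟩
    · exact ⟨1, by simp⟩

/-- Weyl operators square to a sign, so their eigenvalues on `ψ` are powers of `i` and can be scaled
to one. Hence `L` lies in `vecs (stabGroup ψ)`, and a subspace containing a coisotropic one is
coisotropic. -/
theorem IsStab.orthogonal_vecs_le (h : IsStab ψ) (h0 : ψ ≠ 0) :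
    sform.orthogonal (vecs (stabGroup ψ)) ≤ vecs (stabGroup ψ) := by
  obtain ⟨L, hL, h⟩ := h
  have hle : L ≤ vecs (stabGroup ψ) := fun v hv => by
    obtain ⟨c, hc⟩ := h v hv
    have h2 : (c * c) • ψ = sgn (∑ i, (v i).1 * (v i).2) • ψ := by
      rw [← smul_smul, ← hc, ← Matrix.mulVec_smul, ← hc, Matrix.mulVec_mulVec, weyl_mul_self,
        Matrix.smul_mulVec, Matrix.one_mulVec]
    obtain ⟨k, hk⟩ := exists_I_pow_mul_eq_one (smul_left_injective ℂ h0 h2)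
    obtain ⟨p, hp⟩ := Pauli.exists_op_eq_smul_weyl k v
    refine ⟨p, ?_, Pauli.vec_eq hp⟩
    rw [mem_stabGroup, hp, Matrix.smul_mulVec, hc, smul_smul, hk, one_smul]
  exact (LinearMap.BilinForm.orthogonal_le hle).trans (hL.trans hle)

theorem exists_mem_sform_ne_zero {S : Subgroup (Pauli ι)}
    (h : sform.orthogonal (vecs S) ≤ vecs S) {v : PhaseSpace ι} (hv : v ∉ vecs S) :
    ∃ p ∈ S, sform p.vec v ≠ 0 := by
  by_contra! hc
  refine hv (h ?_)
  rintro _ ⟨p, hp, rfl⟩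
  exact hc p hp

open scoped ComplexOrder in
/-- A stabilizer state is determined by its stabilizer group. -/
theorem IsStab.eq_smul_of_stabilizes (h : IsStab ψ) (h0 : ψ ≠ 0) {φ : (ι → Fin 2) → ℂ}
    (hφ : Stabilizes (stabGroup ψ) φ) : ∃ c : ℂ, φ = c • ψ := by
  have hS := isStabilizerGroup_stabGroup h0
  have := hS.finite
  have := Fintype.ofFinite (stabGroup ψ)
  have hleft : ∀ p ∈ stabGroup ψ, p.op * Matrix.vecMulVec ψ (star ψ) = Matrix.vecMulVec ψ (star ψ) :=
    fun p hp => by rw [Matrix.mul_vecMulVec, mem_stabGroup.mp hp]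
  have hright : ∀ p ∈ stabGroup ψ,
      Matrix.vecMulVec ψ (star ψ) * p.op = Matrix.vecMulVec ψ (star ψ) := fun p hp => by
    have h1 : p.opᴴ *ᵥ ψ = ψ := by
      conv_lhs => rw [← mem_stabGroup.mp hp]
      rw [Matrix.mulVec_mulVec, p.conjTranspose_mul_self, Matrix.one_mulVec]
    have h2 := Matrix.star_mulVec p.opᴴ ψ
    rw [h1, Matrix.conjTranspose_conjTranspose] at h2
    rw [Matrix.vecMulVec_mul, ← h2]
  have key := hS.smul_eq_trace_smul_finsum hleft fun v hv => by
    obtain ⟨p, hp, hpv⟩ := exists_mem_sform_ne_zero (h.orthogonal_vecs_le h0) hv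
    exact ⟨p, by rw [hleft p hp, hright p hp], hpv⟩
  have ht : (Matrix.vecMulVec ψ (star ψ)).trace ≠ 0 := by
    rw [Matrix.trace_vecMulVec]
    exact fun hz => h0 (dotProduct_self_star_eq_zero.mp hz)
  have hcard : (Fintype.card (stabGroup ψ) : ℂ) ≠ 0 := Nat.cast_ne_zero.mpr Fintype.card_ne_zero
  -- Applied to `φ`, the rank one side gives a multiple of `ψ`, while the sum over the group
  -- multiplies `φ` by a nonzero number.
  have key' := congrArg (fun M => M *ᵥ φ) key
  simp only [finsum_eq_sum_of_fintype, Matrix.smul_mulVec, Matrix.sum_mulVec, hφ _ (Subtype.prop _),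
    Finset.sum_const, Finset.card_univ, Matrix.vecMulVec_mulVec, op_smul_eq_smul,
    ← Nat.cast_smul_eq_nsmul ℂ, smul_smul] at key'
  exact ⟨_, ((inv_smul_eq_iff₀ (mul_ne_zero ht hcard)).mpr key').symm.trans (smul_smul _ _ _)⟩

end StabilizerGroup

/-! ## Logical Pauli groups of a bipartition -/

/-- Goursat's lemma: `I` surjects onto both quotients, and the two kernels agree because, for `(a,
b)` in `I`, the pair `(a, 1)` lies in `I` exactly when `(1, b)` does. -/
theorem Subgroup.exists_mulEquiv_of_correspondence {G H : Type*} [Group G] [Group H]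
    (I : Subgroup (G × H)) {SA NA : Subgroup G} {SB NB : Subgroup H}
    [(SA.subgroupOf NA).Normal] [(SB.subgroupOf NB).Normal]
    (hSA : ∀ a, a ∈ SA ↔ (a, 1) ∈ I) (hSB : ∀ b, b ∈ SB ↔ (1, b) ∈ I)
    (hNA : ∀ a, a ∈ NA ↔ ∃ b, (a, b) ∈ I) (hNB : ∀ b, b ∈ NB ↔ ∃ a, (a, b) ∈ I) :
    ∃ φ : NA ⧸ SA.subgroupOf NA ≃* NB ⧸ SB.subgroupOf NB, ∀ (a : NA) (b : NB),
      φ (QuotientGroup.mk a) = QuotientGroup.mk b ↔ ((a : G), (b : H)) ∈ I := by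
  let f : I →* NA := ((MonoidHom.fst G H).comp I.subtype).codRestrict NA
    fun x => (hNA _).mpr ⟨_, x.2⟩
  let g : I →* NB := ((MonoidHom.snd G H).comp I.subtype).codRestrict NB
    fun x => (hNB _).mpr ⟨_, x.2⟩
  let F := (QuotientGroup.mk' (SA.subgroupOf NA)).comp f
  let K := (QuotientGroup.mk' (SB.subgroupOf NB)).comp g
  have hF : Function.Surjective F := (QuotientGroup.mk'_surjective _).comp fun a => by
    obtain ⟨b, hb⟩ := (hNA a).mp a.2
    exact ⟨⟨_, hb⟩, rfl⟩
  have hK : Function.Surjective K := (QuotientGroup.mk'_surjective _).comp fun b => by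
    obtain ⟨a, ha⟩ := (hNB b).mp b.2
    exact ⟨⟨_, ha⟩, rfl⟩
  have hFmem : ∀ x : I, x ∈ F.ker ↔ x.1.1 ∈ SA := fun x => by
    rw [MonoidHom.mem_ker]
    exact QuotientGroup.eq_one_iff (f x)
  have hKmem : ∀ x : I, x ∈ K.ker ↔ x.1.2 ∈ SB := fun x => by
    rw [MonoidHom.mem_ker]
    exact QuotientGroup.eq_one_iff (g x)
  have hker : F.ker = K.ker := by
    ext ⟨⟨a, b⟩, hab⟩
    rw [hFmem, hKmem, hSA, hSB]
    refine ⟨fun h => ?_, fun h => ?_⟩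
    · simpa using I.mul_mem (I.inv_mem h) hab
    · simpa using I.mul_mem hab (I.inv_mem h)
  let φ := (QuotientGroup.quotientKerEquivOfSurjective F hF).symm.trans
    ((QuotientGroup.quotientMulEquivOfEq hker).trans
      (QuotientGroup.quotientKerEquivOfSurjective K hK))
  have hφ : ∀ x : I, φ (F x) = K x := fun x => by
    have h : (QuotientGroup.quotientKerEquivOfSurjective F hF).symm (F x) = QuotientGroup.mk x :=
      (MulEquiv.symm_apply_eq _).mpr rfl
    change QuotientGroup.quotientKerEquivOfSurjective K hK
      (QuotientGroup.quotientMulEquivOfEq hker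
        ((QuotientGroup.quotientKerEquivOfSurjective F hF).symm (F x))) = K x
    rw [h]
    rfl
  refine ⟨φ, fun a b => ?_⟩
  obtain ⟨b', hb'⟩ := (hNA a).mp a.2
  have h1 : φ (QuotientGroup.mk a) = QuotientGroup.mk (g ⟨_, hb'⟩) := hφ ⟨_, hb'⟩
  rw [h1, QuotientGroup.eq, Subgroup.mem_subgroupOf, hSB]
  refine ⟨fun h => ?_, fun h => ?_⟩
  · simpa [g] using I.mul_mem hb' h
  · simpa [g] using I.mul_mem (I.inv_mem hb') h

theorem Matrix.map_star_mul {n : Type*} [Fintype n] (M N : Matrix n n ℂ) :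
    (M * N).map star = M.map star * N.map star := by
  ext x y
  simp [Matrix.mul_apply]

namespace Pauli

variable {ι : Type*} [Fintype ι] [DecidableEq ι]

theorem op_map_star {p : Pauli ι} {k : ℕ} {v : PhaseSpace ι} (h : p.op = Complex.I ^ k • weyl v) :
    p.op.map star = Complex.I ^ (3 * k) • weyl v := by
  ext x y
  have hw : star (weyl v x y) = weyl v x y := congrFun₂ (weyl_map_star v) x y
  simp only [h, Matrix.map_apply, Matrix.smul_apply, smul_eq_mul, star_mul', star_pow, hw]
  rw [pow_mul, Complex.star_def, Complex.conj_I, show Complex.I ^ 3 = -Complex.I by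
    rw [pow_succ, Complex.I_sq, neg_one_mul]]

theorem one_map_star : (1 : Pauli ι).op.map star = 1 := by
  rw [op_one]
  exact Matrix.map_one star (star_zero ℂ) (star_one ℂ)

/-- Conjugation preserves exponents, and `S` has at most one element with given exponents; so the
normalizer is the centralizer. -/
theorem mem_normalizer_iff {S : Subgroup (Pauli ι)} (hS : IsStabilizerGroup S) {a : Pauli ι} :
    a ∈ Subgroup.normalizer (S : Set (Pauli ι)) ↔ ∀ p ∈ S, sform a.vec p.vec = 0 := by
  have hv : ∀ p : Pauli ι, (a * p * a⁻¹).vec = p.vec := fun p => by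
    rw [vec_mul, vec_mul, vec_inv, add_comm, ← add_assoc, phaseSpace_add_self, zero_add]
  rw [Subgroup.mem_normalizer_iff]
  refine ⟨fun h p hp => ?_, fun h p => ?_⟩
  · have h1 := hS.eq_of_vec_eq ((h p).mp hp) hp (hv p)
    exact mul_comm_iff.mp (mul_inv_eq_iff_eq_mul.mp h1)
  · have key : sform a.vec p.vec = 0 → a * p * a⁻¹ = p := fun h0 =>
      mul_inv_eq_iff_eq_mul.mpr (mul_comm_iff.mpr h0)
    refine ⟨fun hp => ?_, fun hp => ?_⟩
    · rw [key (h p hp)]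
      exact hp
    · have h1 := h _ hp
      rw [hv] at h1
      rw [key h1] at hp
      exact hp

end Pauli

section Correspondence

variable {ι α β : Type*} [Fintype ι] [Fintype α] [Fintype β] [DecidableEq ι] [DecidableEq α]
  [DecidableEq β] (e : α ⊕ β ≃ ι)

/-- The pairs `(a, b)` such that `a* ⊗ b` is in `S`. -/
def corr (S : Subgroup (Pauli ι)) : Subgroup (Pauli α × Pauli β) where
  carrier := {x | ∃ p ∈ S, p.op = tensorAlong e (x.1.op.map star) x.2.op}
  mul_mem' := by
    rintro x y ⟨p, hp, hx⟩ ⟨q, hq, hy⟩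
    refine ⟨p * q, mul_mem hp hq, ?_⟩
    rw [Pauli.op_mul, hx, hy, tensorAlong_mul, ← Matrix.map_star_mul]
    rfl
  one_mem' := by
    refine ⟨1, one_mem S, ?_⟩
    change _ = tensorAlong e ((1 : Pauli α).op.map star) (1 : Pauli β).op
    rw [Pauli.one_map_star, Pauli.op_one, Pauli.op_one, tensorAlong_one]
  inv_mem' := by
    rintro x ⟨p, hp, hx⟩
    refine ⟨p⁻¹, inv_mem hp, ?_⟩
    refine left_inv_eq_right_inv p.op_inv_mul ?_
    change _ * tensorAlong e (x.1⁻¹.op.map star) x.2⁻¹.op = 1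
    rw [hx, tensorAlong_mul, ← Matrix.map_star_mul, Pauli.op_mul_inv, Pauli.op_mul_inv,
      ← Pauli.op_one, Pauli.one_map_star, tensorAlong_one]

variable {e} {S : Subgroup (Pauli ι)}

theorem mem_corr {a : Pauli α} {b : Pauli β} :
    (a, b) ∈ corr e S ↔ ∃ p ∈ S, p.op = tensorAlong e (a.op.map star) b.op := Iff.rfl

theorem vec_eq_glue {p : Pauli ι} {a : Pauli α} {b : Pauli β}
    (h : p.op = tensorAlong e (a.op.map star) b.op) : p.vec = glue e a.vec b.vec := by
  obtain ⟨k, hk⟩ := a.op_eq_smul_weyl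
  obtain ⟨l, hl⟩ := b.op_eq_smul_weyl
  refine Pauli.vec_eq (c := Complex.I ^ (3 * k) * Complex.I ^ l) ?_
  rw [h, Pauli.op_map_star hk, hl, tensorAlong_smul_smul, weyl_along e, resL_glue, resR_glue]

theorem exists_right_of_vec_eq {p : Pauli ι} (hp : p ∈ S) {a : Pauli α}
    (h : a.vec = resL e p.vec) : ∃ b : Pauli β, (a, b) ∈ corr e S ∧ b.vec = resR e p.vec := by
  obtain ⟨k, hk⟩ := a.op_eq_smul_weyl
  obtain ⟨l, hl⟩ := p.op_eq_smul_weyl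
  -- Conjugating `a` turns its phase into `i ^ (-k)`, so `b` must carry `l + k` to restore the phase
  -- of `p`.
  obtain ⟨b, hb⟩ := Pauli.exists_op_eq_smul_weyl (l + k) (resR e p.vec)
  refine ⟨b, ⟨p, hp, ?_⟩, Pauli.vec_eq hb⟩
  rw [Pauli.op_map_star hk, hb, tensorAlong_smul_smul, h, ← weyl_along, hl, ← pow_add,
    show 3 * k + (l + k) = 4 * k + l by ring, pow_add, pow_mul, Complex.I_pow_four, one_pow,
    one_mul]

theorem exists_left_of_vec_eq {p : Pauli ι} (hp : p ∈ S) {b : Pauli β}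
    (h : b.vec = resR e p.vec) : ∃ a : Pauli α, (a, b) ∈ corr e S ∧ a.vec = resL e p.vec := by
  obtain ⟨k, hk⟩ := b.op_eq_smul_weyl
  obtain ⟨l, hl⟩ := p.op_eq_smul_weyl
  obtain ⟨a, ha⟩ := Pauli.exists_op_eq_smul_weyl (3 * l + k) (resL e p.vec)
  refine ⟨a, ⟨p, hp, ?_⟩, Pauli.vec_eq ha⟩
  rw [Pauli.op_map_star ha, hk, tensorAlong_smul_smul, h, ← weyl_along, hl, ← pow_add,
    show 3 * (3 * l + k) + k = 4 * (2 * l + k) + l by ring, pow_add, pow_mul, Complex.I_pow_four,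
    one_pow, one_mul]

theorem sform_add_sform_eq_zero (hS : IsStabilizerGroup S) {a a' : Pauli α} {b b' : Pauli β}
    (h : (a, b) ∈ corr e S) (h' : (a', b') ∈ corr e S) :
    sform a.vec a'.vec + sform b.vec b'.vec = 0 := by
  obtain ⟨p, hp, hpe⟩ := h
  obtain ⟨q, hq, hqe⟩ := h'
  have h0 := Pauli.mul_comm_iff.mp (hS.comm p hp q hq)
  rwa [vec_eq_glue hpe, vec_eq_glue hqe, sform_along e, resL_glue, resL_glue, resR_glue,
    resR_glue] at h0

variable (e S) in
/-- The elements of `S` that are trivial on the second part, up to conjugation. -/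
def leftGroup : Subgroup (Pauli α) := (corr e S).comap (MonoidHom.inl _ _)

variable (e S) in
/-- The elements of `S` that are trivial on the first part. -/
def rightGroup : Subgroup (Pauli β) := (corr e S).comap (MonoidHom.inr _ _)

theorem mem_leftGroup {a : Pauli α} : a ∈ leftGroup e S ↔ (a, 1) ∈ corr e S := Iff.rfl

theorem mem_rightGroup {b : Pauli β} : b ∈ rightGroup e S ↔ (1, b) ∈ corr e S := Iff.rfl

theorem tensorAlong_neg_one_one : tensorAlong e (-1 : QubitOp α) (1 : QubitOp β) = -1 := by
  have h := tensorAlong_smul_smul e (-1) 1 (1 : QubitOp α) (1 : QubitOp β)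
  rwa [tensorAlong_one, neg_one_smul, one_smul, mul_one, neg_one_smul] at h

theorem tensorAlong_one_neg_one : tensorAlong e (1 : QubitOp α) (-1 : QubitOp β) = -1 := by
  have h := tensorAlong_smul_smul e 1 (-1) (1 : QubitOp α) (1 : QubitOp β)
  rwa [tensorAlong_one, neg_one_smul, one_smul, one_mul, neg_one_smul] at h

theorem isStabilizerGroup_leftGroup (hS : IsStabilizerGroup S) :
    IsStabilizerGroup (leftGroup e S) where
  comm a ha a' ha' := Pauli.mul_comm_iff.mpr <| by
    simpa using sform_add_sform_eq_zero hS (mem_leftGroup.mp ha) (mem_leftGroup.mp ha')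
  neg_one_notMem a ha h := by
    obtain ⟨p, hp, hpe⟩ := mem_corr.mp (mem_leftGroup.mp ha)
    refine hS.neg_one_notMem p hp ?_
    rw [hpe, h, Pauli.op_one, ← tensorAlong_neg_one_one (e := e)]
    congr 1
    ext x y
    simp [Matrix.one_apply, apply_ite]

theorem isStabilizerGroup_rightGroup (hS : IsStabilizerGroup S) :
    IsStabilizerGroup (rightGroup e S) where
  comm b hb b' hb' := Pauli.mul_comm_iff.mpr <| by
    simpa using sform_add_sform_eq_zero hS (mem_rightGroup.mp hb) (mem_rightGroup.mp hb')
  neg_one_notMem b hb h := by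
    obtain ⟨p, hp, hpe⟩ := mem_corr.mp (mem_rightGroup.mp hb)
    refine hS.neg_one_notMem p hp ?_
    rw [hpe, h, Pauli.one_map_star, tensorAlong_one_neg_one]

/-- Reduction by the zero subspace: what is orthogonal to the part of `vecs S` supported on the
inputs is the restriction of a vector orthogonal to `vecs S`, which lies in `vecs S` by `hL`. -/
theorem mem_normalizer_leftGroup (hS : IsStabilizerGroup S)
    (hL : sform.orthogonal (vecs S) ≤ vecs S) {a : Pauli α} :
    a ∈ Subgroup.normalizer (leftGroup e S : Set (Pauli α)) ↔ ∃ b, (a, b) ∈ corr e S := by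
  rw [Pauli.mem_normalizer_iff (isStabilizerGroup_leftGroup hS)]
  refine ⟨fun h => ?_, fun ⟨b, hb⟩ c hc => ?_⟩
  · let e' : β ⊕ α ≃ ι := (Equiv.sumComm β α).trans e
    obtain ⟨l, ⟨hl, -⟩, hla⟩ := orthogonal_reduction_le e' (vecs S) ⊥ <|
      show a.vec ∈ sform.orthogonal ((vecs S ⊓ Submodule.comap (resL e') ⊥).map (resR e')) by
        rintro _ ⟨_, ⟨⟨p, hp, rfl⟩, hp0⟩, rfl⟩
        obtain ⟨c, hc, hcv⟩ := exists_left_of_vec_eq (e := e) hp (b := 1)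
          (Pauli.vec_one.trans ((Submodule.mem_bot (ZMod 2)).mp hp0).symm)
        change sform (resL e p.vec) a.vec = 0
        rw [← hcv, sform_comm]
        exact h c hc
    obtain ⟨p, hp, rfl⟩ := hL hl
    obtain ⟨b, hb, -⟩ := exists_right_of_vec_eq (e := e) hp hla.symm
    exact ⟨b, hb⟩
  · simpa using sform_add_sform_eq_zero hS hb (mem_leftGroup.mp hc)

theorem mem_normalizer_rightGroup (hS : IsStabilizerGroup S)
    (hL : sform.orthogonal (vecs S) ≤ vecs S) {b : Pauli β} :
    b ∈ Subgroup.normalizer (rightGroup e S : Set (Pauli β)) ↔ ∃ a, (a, b) ∈ corr e S := by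
  rw [Pauli.mem_normalizer_iff (isStabilizerGroup_rightGroup hS)]
  refine ⟨fun h => ?_, fun ⟨a, ha⟩ c hc => ?_⟩
  · obtain ⟨l, ⟨hl, -⟩, hlb⟩ := orthogonal_reduction_le e (vecs S) ⊥ <|
      show b.vec ∈ sform.orthogonal ((vecs S ⊓ Submodule.comap (resL e) ⊥).map (resR e)) by
        rintro _ ⟨_, ⟨⟨p, hp, rfl⟩, hp0⟩, rfl⟩
        obtain ⟨c, hc, hcv⟩ := exists_right_of_vec_eq (e := e) hp (a := 1)
          (Pauli.vec_one.trans ((Submodule.mem_bot (ZMod 2)).mp hp0).symm)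
        rw [← hcv, sform_comm]
        exact h c hc
    obtain ⟨p, hp, rfl⟩ := hL hl
    obtain ⟨a, ha, -⟩ := exists_left_of_vec_eq (e := e) hp hlb.symm
    exact ⟨a, ha⟩
  · simpa using sform_add_sform_eq_zero hS ha (mem_rightGroup.mp hc)

variable {ψ : (ι → Fin 2) → ℂ}

theorem asMap_mul_op (hψ : Stabilizes S ψ) {a : Pauli α} {b : Pauli β} (h : (a, b) ∈ corr e S) :
    asMap e ψ * a.op = b.op * asMap e ψ := by
  obtain ⟨p, hp, hpe⟩ := h
  have h1 := congrArg (asMap e) (hψ p hp)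
  rw [hpe, asMap_tensorAlong_mulVec] at h1
  have h2 : (a.op.map star)ᵀ = a.opᴴ := rfl
  conv_lhs => rw [← h1]
  rw [Matrix.mul_assoc, h2, a.conjTranspose_mul_self, Matrix.mul_one]

theorem op_mul_asMap_conjTranspose (hψ : Stabilizes S ψ) {a : Pauli α} {b : Pauli β}
    (h : (a, b) ∈ corr e S) : a.op * (asMap e ψ)ᴴ = (asMap e ψ)ᴴ * b.op := by
  have h1 : asMap e ψ * a.opᴴ = b.opᴴ * asMap e ψ := by
    calc asMap e ψ * a.opᴴ = b.opᴴ * (b.op * asMap e ψ) * a.opᴴ := by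
          rw [← Matrix.mul_assoc, b.conjTranspose_mul_self, Matrix.one_mul]
      _ = b.opᴴ * asMap e ψ := by
          rw [← asMap_mul_op hψ h, Matrix.mul_assoc, Matrix.mul_assoc, a.mul_conjTranspose_self,
            Matrix.mul_one]
  have h2 := congrArg Matrix.conjTranspose h1
  simpa only [Matrix.conjTranspose_mul, Matrix.conjTranspose_conjTranspose] using h2

open scoped ComplexOrder in
-- The product is fixed by the output group and commutes with every `b` in a pair of `corr e S`;
-- these are enough symmetries to kill all Weyl coefficients off that group.
theorem exists_asMap_mul_conjTranspose (hS : IsStabilizerGroup S)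
    (hL : sform.orthogonal (vecs S) ≤ vecs S) (hψ : Stabilizes S ψ) :
    ∃ c : ℝ, (ψ ≠ 0 → 0 < c) ∧
      asMap e ψ * (asMap e ψ)ᴴ = (c : ℂ) • codeProjector (rightGroup e S) := by
  have hB := isStabilizerGroup_rightGroup (e := e) hS
  have := hB.finite
  have key := hB.smul_eq_trace_smul_finsum (ρ := asMap e ψ * (asMap e ψ)ᴴ)
    (fun b hb => by
      rw [← Matrix.mul_assoc, ← asMap_mul_op hψ (mem_rightGroup.mp hb), Pauli.op_one,
        Matrix.mul_one])
    (fun v hv => by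
      -- Since `vecs S` is coisotropic, some element of `S` anticommutes with this extension by
      -- zero; its output part is the symmetry sought.
      have hv' : glue e 0 v ∉ vecs S := fun ⟨p, hp, hpv⟩ => hv <| by
        obtain ⟨b, hb, hbv⟩ := exists_right_of_vec_eq (e := e) hp (a := 1)
          (by rw [hpv, resL_glue, Pauli.vec_one])
        exact ⟨b, hb, by rw [hbv, hpv, resR_glue]⟩
      obtain ⟨p, hp, hpv⟩ := exists_mem_sform_ne_zero hL hv'
      obtain ⟨a, ha⟩ := Pauli.exists_vec_eq (resL e p.vec)
      obtain ⟨b, hab, hb⟩ := exists_right_of_vec_eq hp ha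
      refine ⟨b, ?_, ?_⟩
      · rw [← Matrix.mul_assoc, ← asMap_mul_op hψ hab, Matrix.mul_assoc,
          op_mul_asMap_conjTranspose hψ hab, Matrix.mul_assoc]
      · rwa [sform_along e, resL_glue, resR_glue, map_zero, zero_add, ← hb] at hpv)
  have hpos := (Matrix.posSemidef_self_mul_conjTranspose (asMap e ψ)).trace_nonneg
  have hre : ((asMap e ψ * (asMap e ψ)ᴴ).trace.re : ℂ) = (asMap e ψ * (asMap e ψ)ᴴ).trace :=
    (Complex.eq_re_of_ofReal_le hpos).symm
  have hcard : (Nat.card (rightGroup e S) : ℂ) ≠ 0 := Nat.cast_ne_zero.mpr Nat.card_pos.ne'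
  -- The trace is the squared norm of `ψ`; the group order undoes the normalization of the
  -- projector.
  refine ⟨(asMap e ψ * (asMap e ψ)ᴴ).trace.re * Nat.card (rightGroup e S) / 2 ^ Fintype.card β,
    fun h0 => ?_, ?_⟩
  · have hne : (asMap e ψ * (asMap e ψ)ᴴ).trace ≠ 0 := fun hz => h0 <| asMap_injective e <|
      Matrix.trace_mul_conjTranspose_self_eq_zero_iff.mp hz
    have h1 : 0 < (asMap e ψ * (asMap e ψ)ᴴ).trace.re :=
      (Complex.pos_iff.mp (lt_of_le_of_ne hpos hne.symm)).1
    have h2 : 0 < Nat.card (rightGroup e S) := Nat.card_pos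
    positivity
  · have h2 : (2 ^ Fintype.card β : ℂ) ≠ 0 := by positivity
    refine (inv_smul_smul₀ h2 _).symm.trans ?_
    rw [key, codeProjector, smul_smul, smul_smul]
    congr 1
    push_cast
    rw [hre]
    field_simp

end Correspondence

/-! ### Complementary sets of qubits and vanishing networks -/

section MainTheorem

variable {ι : Type*} [Fintype ι] [DecidableEq ι]

/-- A set of qubits and its complement. -/
def complEquiv (A : Finset ι) : A ⊕ ↥(Aᶜ) ≃ ι :=
  (Equiv.sumCongr (Equiv.refl _) (Equiv.subtypeEquivRight fun _ => Finset.mem_compl)).trans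
    (Equiv.sumCompl (· ∈ A))

theorem stateAsMap_eq (A : Finset ι) (ψ : (ι → Fin 2) → ℂ) :
    stateAsMap A ψ = asMap (complEquiv A) ψ := by
  ext y x
  refine congrArg ψ (funext ((forall_along (complEquiv A)).mpr ⟨fun i => ?_, fun j => ?_⟩))
  · rw [glue_inl]
    exact dif_pos i.2
  · rw [glue_inr]
    exact dif_neg (Finset.mem_compl.mp j.2)

/-- A network that vanishes is given the stabilizer group of a basis state. -/
theorem IsStab.exists_ne_zero {ψ : (ι → Fin 2) → ℂ} (h : IsStab ψ) :
    ∃ φ : (ι → Fin 2) → ℂ, IsStab φ ∧ φ ≠ 0 ∧ (ψ ≠ 0 → ψ = φ) := by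
  by_cases h0 : ψ = 0
  · exact ⟨_, isStab_basis, fun hz => one_ne_zero
      (by simpa using congrFun hz 0 : (1 : ℂ) = 0), fun h1 => absurd h0 h1⟩
  · exact ⟨ψ, h, h0, fun _ => rfl⟩

end MainTheorem

end

theorem mainTheorem1 {V : Type*} [Fintype V] [DecidableEq V] (T : RGBNetwork V) :
    ∃ S : Subgroup (Pauli T.OpenLeg),
      -- the network, read as a state, has a stabilizer group of full rank
      IsStabilizerGroup S ∧
      HasRank S (Fintype.card T.OpenLeg) ∧
      Stabilizes S T.tensor ∧
      -- unless it vanishes, the network is the only state stabilized by `S`, up to a factor,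
      -- and `S` contains all the Paulis that stabilize the network
      (T.tensor ≠ 0 →
        (∀ ψ : (T.OpenLeg → Fin 2) → ℂ, Stabilizes S ψ → ∃ c : ℂ, ψ = c • T.tensor) ∧
        ∀ p : Pauli T.OpenLeg, p.op *ᵥ T.tensor = T.tensor → p ∈ S) ∧
      -- the isomorphism for the inputs `A` and the outputs `Aᶜ`
      ∀ A : Finset T.OpenLeg,
        ∃ (S_A : Subgroup (Pauli A)) (S_B : Subgroup (Pauli ↥(Aᶜ)))
          (φ : LogicalPauli S_A ≃* LogicalPauli S_B) (c : ℝ),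
          IsStabilizerGroup S_A ∧
          IsStabilizerGroup S_B ∧
          (∀ a : Pauli A, a ∈ S_A ↔ Correspond S A a 1) ∧
          (∀ b : Pauli ↥(Aᶜ), b ∈ S_B ↔ Correspond S A 1 b) ∧
          (T.tensor ≠ 0 → 0 < c) ∧
          ∀ (a : ↥(Subgroup.normalizer (S_A : Set (Pauli A))))
            (b : ↥(Subgroup.normalizer (S_B : Set (Pauli ↥(Aᶜ))))),
            (φ (QuotientGroup.mk a) = QuotientGroup.mk b ↔ Correspond S A a b) ∧
            (φ (QuotientGroup.mk a) = QuotientGroup.mk b →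
              stateAsMap A T.tensor * (a : Pauli A).op
                = (b : Pauli ↥(Aᶜ)).op * stateAsMap A T.tensor ∧
              stateAsMap A T.tensor * (a : Pauli A).op * (stateAsMap A T.tensor)ᴴ
                = (c : ℂ) • ((b : Pauli ↥(Aᶜ)).op * codeProjector S_B)) := by
  -- The group is that of `ψ`, which is the network or, if that vanishes, a basis state; any group
  -- fixes the zero vector.
  obtain ⟨ψ, hψ, h0, hT⟩ := T.isStab_tensor.exists_ne_zero
  have hS := isStabilizerGroup_stabGroup h0
  have hL := hψ.orthogonal_vecs_le h0
  have hst : Stabilizes (stabGroup ψ) T.tensor := fun p hp => by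
    by_cases h : T.tensor = 0
    · rw [h, Matrix.mulVec_zero]
    · rw [hT h, mem_stabGroup.mp hp]
  refine ⟨stabGroup ψ, hS, hS.finrank_vecs hL ▸ hS.hasRank, hst, fun h => ?_, fun A => ?_⟩
  · rw [hT h]
    exact ⟨fun φ hφ => hψ.eq_smul_of_stabilizes h0 hφ, fun p hp => hp⟩
  · obtain ⟨φ, hφ⟩ := Subgroup.exists_mulEquiv_of_correspondence
      (corr (complEquiv A) (stabGroup ψ)) (fun _ => mem_leftGroup) (fun _ => mem_rightGroup)
      (fun _ => mem_normalizer_leftGroup hS hL) (fun _ => mem_normalizer_rightGroup hS hL)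
    obtain ⟨c, hc, hM⟩ := exists_asMap_mul_conjTranspose (e := complEquiv A) hS hL hst
    refine ⟨leftGroup (complEquiv A) (stabGroup ψ), rightGroup (complEquiv A) (stabGroup ψ), φ, c,
      isStabilizerGroup_leftGroup hS, isStabilizerGroup_rightGroup hS, fun _ => Iff.rfl,
      fun _ => Iff.rfl, hc, fun a b => ⟨hφ a b, fun hab => ?_⟩⟩
    have hMa := asMap_mul_op hst ((hφ a b).mp hab)
    rw [stateAsMap_eq, hMa, Matrix.mul_assoc, hM, Matrix.mul_smul]
    exact ⟨rfl, rfl⟩
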